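/- Multigraphs may have loops and multiple edges, and are finite and connected. Let $X$ be a multigraph without vertices of degree one, and let $\pi\colon Y\to X$ be an abelian cover of multigraphs, i.e. a covering map (of the associated one-dimensional CW complexes) with $Y$ a multigraph, whose automorphism group $G=\mathrm{Aut}(Y/X)$ is abelian and acts transitively on the fibres of $\pi$. A prime path in $X$ is a closed path $e_1\cdots e_m$ ($m\ge 1$) of oriented edges with $e_{i+1}\neq e_i^{-1}$ for $1\le i<m$ and $e_1\neq e_m^{-1}$, which is not of the form $C^a$ for a closed path $C$ and an integer $a\ge 2$. A prime $\mathfrak p$ of $X$ is an equivalence class of prime paths under cyclic rotation, and $\nu(\mathfrak p)$ is its length $m$. The Frobenius automorphism of $\mathfrak p$ is the unique $\mathrm{Frob}_{\mathfrak p}\in G$ such that, for a prime path in the class $\mathfrak p$ with initial vertex $v$ and a vertex $w$ of $Y$ above $v$, the lift of this path to $Y$ with initial vertex $w$ ends at $\mathrm{Frob}_{\mathfrak p}\cdot w$; since $G$ is abelian it does not depend on the choices. For a character $\chi\colon G\to\mathbb C^\times$, the Artin–Ihara $L$-function is $$L_{Y/X}(u,\chi)=\prod_{\mathfrak p}\bigl(1-\chi(\mathrm{Frob}_{\mathfrak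 p})\,u^{\nu(\mathfrak p)}\bigr)^{-1}$$ for $|u|$ sufficiently small (the product being over all primes of $X$), extended meromorphically to $\mathbb C$. Let $v_1,\dots,v_n$ be the vertices of $X$, fix for each $i$ a vertex $w_i$ of $Y$ above $v_i$, and let $r_X=|E_X|-|V_X|+1$, where $V_X$ and $E_X$ are the sets of vertices and edges. Let $D$ be the diagonal $n\times n$ matrix whose $i$-th entry is the degree of $v_i$ (loops counted twice). For $\sigma\in G$ let $A(\sigma)=(a_{ij}(\sigma))$ be the $n\times n$ matrix for which $a_{ii}(1)$ is twice the number of loops at $w_i$, and in all other cases $a_{ij}(\sigma)$ is the number of edges of $Y$ connecting $w_i$ to $\sigma\cdot w_j$. Put $A_\chi=\sum_{\sigma\in G}\chi(\sigma)A(\sigma)$. Let $\chi$ be a nontrivial character of $G$. Then the Euler product converges for $|u|$ sufficiently small and has a meromorphic continuation $L_{Y/X}(u,\chi)$ to $\mathbb C$. The function $L_{Y/X}(u,\chi)^{-1}$ vanishes to order exactly $r_X-1$ at $u=1$, and its leading Taylor coefficient there, i.e. the nonzero number $L^*_{Y/X}(1,\chi)$ with $L_{Y/X}(u,\chi)^{-1}=L^*_{Y/X}(1,\chi)\,(u-1)^{r_X-1}+\cdots$,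 is $$L^*_{Y/X}(1,\chi)=(-2)^{r_X-1}\det(D-A_\chi).$$ -/

import Mathlib

open Filter Topology

universe u₁ v₁ u₂ v₂

/-- A multigraph (loops and multiple edges allowed), presented through its oriented edges.
`Dart` is the set of oriented edges, `src e` is the initial vertex of `e`, and `inv e` is the
edge `e` with the opposite orientation. Every edge, loops included, has exactly two
orientations. -/
structure Multigraph where
  V : Type u₁
  Dart : Type v₁
  src : Dart → V
  inv : Dart → Dart
  inv_inv : ∀ e, inv (inv e) = e
  inv_ne : ∀ e, inv e ≠ e

namespace Multigraph

section Graph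

variable (X : Multigraph.{u₁, v₁})

/-- The terminal vertex of an oriented edge. -/
def tgt (e : X.Dart) : X.V := X.src (X.inv e)

/-- Two oriented edges have the same underlying edge. -/
def edgeSetoid : Setoid X.Dart where
  r a b := a = b ∨ a = X.inv b
  iseqv :=
    { refl := fun _ => Or.inl rfl
      symm := by
        rintro a b (h | h)
        · exact Or.inl h.symm
        · exact Or.inr (by rw [h, X.inv_inv])
      trans := by
        rintro a b c (rfl | rfl) (rfl | rfl)
        · exact Or.inl rfl
        · exact Or.inr rfl
        · exact Or.inr rfl
        · exact Or.inl (X.inv_inv _) }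

/-- The (unoriented) edges. -/
def Edge : Type v₁ := Quotient X.edgeSetoid

instance [Finite X.Dart] : Finite X.Edge := inferInstanceAs (Finite (Quotient X.edgeSetoid))

/-- The unordered pair of end points of an edge. -/
def ends : X.Edge → Sym2 X.V :=
  Quotient.lift (fun e => s(X.src e, X.tgt e)) (by
    rintro a b (rfl | rfl)
    · rfl
    · simp only [tgt, X.inv_inv]
      exact Sym2.eq_swap)

/-- The number of edges whose end points are `v` and `w`. -/
noncomputable def numEdges (v w : X.V) : ℕ := Nat.card {e : X.Edge // X.ends e = s(v, w)}

/-- The number of loops at `v`. -/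
noncomputable def numLoops (v : X.V) : ℕ := X.numEdges v v

/-- The valency of `v`: the number of edges incident to `v`, loops being counted twice. -/
noncomputable def degree (v : X.V) : ℕ :=
  Nat.card {e : X.Edge // v ∈ X.ends e} + X.numLoops v

/-- `r_X = |E_X| - |V_X| + 1`. -/
noncomputable def cycleRank : ℤ := (Nat.card X.Edge : ℤ) - (Nat.card X.V : ℤ) + 1

/-- `X.IsWalk v l w`: the oriented edges in `l` form a path from `v` to `w`
(the empty list being the path of length zero at `v = w`). -/
def IsWalk : X.V → List X.Dart → X.V → Prop
  | v, [], w => v = w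
  | v, e :: l, w => X.src e = v ∧ IsWalk (X.tgt e) l w

/-- A connected multigraph (nonempty, and any two vertices are joined by a path). -/
def IsConnected : Prop := Nonempty X.V ∧ ∀ v w, ∃ l, X.IsWalk v l w

/-- A closed path `e₁ ⋯ eₘ`, with `m ≥ 1`. -/
def IsClosedPath (l : List X.Dart) : Prop := l ≠ [] ∧ ∃ v, X.IsWalk v l v

/-- `eᵢ₊₁ ≠ eᵢ⁻¹` for all `i < m`. -/
def NoBacktrack (l : List X.Dart) : Prop := l.IsChain (fun a b => b ≠ X.inv a)

/-- `e₁ ≠ eₘ⁻¹`. -/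
def NoTail (l : List X.Dart) : Prop := ∀ a ∈ l.head?, ∀ b ∈ l.getLast?, a ≠ X.inv b

/-- A prime path: a closed path without backtracks and without tails, which is not of the form
`C ^ a` with `C` a closed path and `a ≥ 2`. -/
def IsPrimePath (l : List X.Dart) : Prop :=
  X.IsClosedPath l ∧ X.NoBacktrack l ∧ X.NoTail l ∧
    ∀ (C : List X.Dart) (a : ℕ), X.IsClosedPath C → 2 ≤ a → l ≠ (List.replicate a C).flatten

/-- The primes of `X`: classes of prime paths up to cyclic permutation
(`Cycle` is the type of lists up to rotation). -/
def PrimeClass : Type v₁ := {c : Cycle X.Dart // ∃ l, X.IsPrimePath l ∧ (l : Cycle X.Dart) = c}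

/-- The length of a prime. -/
def PrimeClass.length {X : Multigraph.{u₁, v₁}} (p : X.PrimeClass) : ℕ := Cycle.length p.1

/-- The degree matrix of `X`. -/
noncomputable def degreeMatrix [DecidableEq X.V] : Matrix X.V X.V ℂ :=
  Matrix.diagonal fun v => (X.degree v : ℂ)

end Graph

/-- A morphism of multigraphs (compatible with the orientations, as is every cellular map of the
associated one-dimensional CW complexes which is injective on the interior of each edge). -/
structure Hom (Y : Multigraph.{u₂, v₂}) (X : Multigraph.{u₁, v₁}) where
  onV : Y.V → X.V
  onDart : Y.Dart → X.Dart
  src_onDart : ∀ e, X.src (onDart e) = onV (Y.src e)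
  inv_onDart : ∀ e, X.inv (onDart e) = onDart (Y.inv e)

namespace Hom

variable {Y : Multigraph.{u₂, v₂}} {X : Multigraph.{u₁, v₁}} (π : Hom Y X)

/-- A covering map: surjective, and for every vertex `w` of `Y` it maps the oriented edges starting
at `w` bijectively onto the oriented edges starting at `π w`. -/
def IsCovering : Prop :=
  Function.Surjective π.onV ∧
    ∀ w : Y.V, Set.BijOn π.onDart {e | Y.src e = w} {e | X.src e = π.onV w}

/-- `Aut(Y/X)`: the automorphisms of the multigraph `Y` (a permutation of the vertices and one of
the oriented edges) which commute with the projection to `X`. -/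
def deckGroup : Subgroup (Equiv.Perm Y.V × Equiv.Perm Y.Dart) where
  carrier := {g | (∀ e, Y.src (g.2 e) = g.1 (Y.src e)) ∧ (∀ e, Y.inv (g.2 e) = g.2 (Y.inv e)) ∧
    (∀ w, π.onV (g.1 w) = π.onV w) ∧ (∀ e, π.onDart (g.2 e) = π.onDart e)}
  one_mem' := by simp
  mul_mem' := by
    rintro a b ⟨h1, h2, h3, h4⟩ ⟨k1, k2, k3, k4⟩
    refine ⟨?_, ?_, ?_, ?_⟩ <;> intro x <;>
      simp [h1, h2, h3, h4, k1, k2, k3, k4]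
  inv_mem' := by
    rintro a ⟨h1, h2, h3, h4⟩
    refine ⟨fun e => ?_, fun e => ?_, fun w => ?_, fun e => ?_⟩
    · apply a.1.injective
      simp [← h1]
    · apply a.2.injective
      simp [← h2]
    · rw [← h3]
      simp
    · rw [← h4]
      simp

noncomputable instance [Finite Y.V] [Finite Y.Dart] : Fintype π.deckGroup := Fintype.ofFinite _

/-- The action of an automorphism of the cover on the vertices of `Y`. -/
def act (g : π.deckGroup) (w : Y.V) : Y.V := g.1.1 w

end Hom

/-- A Galois (regular) cover `Y/X`, i.e. a covering map whose automorphism group acts transitively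
on the fibres, such that the automorphism group is abelian. -/
structure AbelianCover (Y : Multigraph.{u₂, v₂}) (X : Multigraph.{u₁, v₁}) where
  π : Hom Y X
  isCovering : π.IsCovering
  transitive : ∀ w w' : Y.V, π.onV w = π.onV w' → ∃ g : π.deckGroup, π.act g w = w'
  comm : ∀ g h : π.deckGroup, g * h = h * g

namespace AbelianCover

variable {Y : Multigraph.{u₂, v₂}} {X : Multigraph.{u₁, v₁}} (C : AbelianCover Y X)

/-- The automorphism group `G = Aut(Y/X)`. -/
abbrev G : Type (max u₂ v₂) := C.π.deckGroup

/-- `g` is a Frobenius automorphism at the prime `p`: for some prime path `l` in the class `p`, the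
path `l'` in `Y` which lifts `l` and starts at the vertex `w` ends at `g • w`. -/
def IsFrobenius (p : X.PrimeClass) (g : C.G) : Prop :=
  ∃ (l : List X.Dart) (l' : List Y.Dart) (w : Y.V), X.IsPrimePath l ∧ (l : Cycle X.Dart) = p.1 ∧
    l'.map C.π.onDart = l ∧ Y.IsWalk w l' (C.π.act g w)

/-- Existence of lifts of paths. -/
theorem exists_lift (l : List X.Dart) : ∀ (w : Y.V) (v : X.V), X.IsWalk (C.π.onV w) l v →
    ∃ (l' : List Y.Dart) (w' : Y.V), l'.map C.π.onDart = l ∧ Y.IsWalk w l' w' ∧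
      C.π.onV w' = v := by
  induction l with
  | nil => intro w v h; exact ⟨[], w, rfl, rfl, h⟩
  | cons e l ih =>
    rintro w v ⟨he, hl⟩
    obtain ⟨e', he', rfl⟩ := (C.isCovering.2 w).surjOn he
    have ht : X.tgt (C.π.onDart e') = C.π.onV (Y.tgt e') := by
      simp [tgt, C.π.inv_onDart, C.π.src_onDart]
    rw [ht] at hl
    obtain ⟨l', w', h1, h2, h3⟩ := ih _ _ hl
    exact ⟨e' :: l', w', by simp [h1], ⟨he', h2⟩, h3⟩

theorem exists_isFrobenius (p : X.PrimeClass) : ∃ g : C.G, C.IsFrobenius p g := by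
  obtain ⟨l, hl, hp⟩ := p.2
  obtain ⟨v, hv⟩ := hl.1.2
  obtain ⟨w, rfl⟩ := C.isCovering.1 v
  obtain ⟨l', w', h1, h2, h3⟩ := C.exists_lift l w _ hv
  obtain ⟨g, rfl⟩ := C.transitive w w' h3.symm
  exact ⟨g, l, l', w, hl, hp, h1, h2⟩

/-- The Frobenius automorphism of the prime `p` of `X`. -/
noncomputable def frobenius (p : X.PrimeClass) : C.G := (C.exists_isFrobenius p).choose

/-- Lifts of paths with a given initial vertex are unique. -/
theorem lift_unique (l₁ : List Y.Dart) : ∀ (l₂ : List Y.Dart) (w w₁ w₂ : Y.V),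
    l₁.map C.π.onDart = l₂.map C.π.onDart → Y.IsWalk w l₁ w₁ → Y.IsWalk w l₂ w₂ →
    l₁ = l₂ ∧ w₁ = w₂ := by
  induction l₁ with
  | nil =>
    intro l₂ w w₁ w₂ h h1 h2
    obtain rfl : l₂ = [] := by simpa using h.symm
    exact ⟨rfl, Eq.trans (Eq.symm h1) h2⟩
  | cons e l ih =>
    intro l₂ w w₁ w₂ h h1 h2
    cases l₂ with
    | nil => simp at h
    | cons e₂ l₂ =>
      simp only [List.map_cons, List.cons.injEq] at h
      obtain rfl : e = e₂ := (C.isCovering.2 w).injOn h1.1 h2.1 h.1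
      obtain ⟨rfl, rfl⟩ := ih l₂ _ _ _ h.2 h1.2 h2.2
      exact ⟨rfl, rfl⟩

theorem isWalk_act (g : C.G) (l : List Y.Dart) : ∀ w w' : Y.V, Y.IsWalk w l w' →
    Y.IsWalk (C.π.act g w) (l.map g.1.2) (C.π.act g w') := by
  induction l with
  | nil => rintro w w' rfl; rfl
  | cons e l ih =>
    rintro w w' ⟨rfl, h⟩
    refine ⟨g.2.1 e, ?_⟩
    have := ih _ _ h
    rwa [show C.π.act g (Y.tgt e) = Y.tgt (g.1.2 e) by
      simp only [tgt, Hom.act, g.2.2.1 e, g.2.1]] at this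

theorem act_mul (g h : C.G) (w : Y.V) : C.π.act (g * h) w = C.π.act g (C.π.act h w) := rfl

theorem map_onDart_act (g : C.G) (l : List Y.Dart) :
    (l.map g.1.2).map C.π.onDart = l.map C.π.onDart := by
  simp only [List.map_map]
  exact List.map_congr_left fun e _ => g.2.2.2.2 e

/-- The automorphism group acts freely on the vertices of a connected cover. -/
theorem act_injective (hY : Y.IsConnected) (g h : C.G) (w : Y.V)
    (hw : C.π.act g w = C.π.act h w) : g = h := by
  have key : ∀ w', C.π.act g w' = C.π.act h w' := fun w' => by
    obtain ⟨l, hl⟩ := hY.2 w w'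
    refine (C.lift_unique (l.map g.1.2) (l.map h.1.2) (C.π.act g w) _ _ ?_
      (C.isWalk_act g l _ _ hl) ?_).2
    · rw [map_onDart_act, map_onDart_act]
    · rw [hw]; exact C.isWalk_act h l _ _ hl
  refine Subtype.ext (Prod.ext (Equiv.ext key) (Equiv.ext fun e => ?_))
  refine (C.isCovering.2 (C.π.act g (Y.src e))).injOn (g.2.1 e) ?_ ?_
  · rw [key]; exact h.2.1 e
  · rw [g.2.2.2.2 e, h.2.2.2.2 e]

theorem isWalk_append (l₁ l₂ : List Y.Dart) : ∀ w w' : Y.V,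
    Y.IsWalk w (l₁ ++ l₂) w' ↔ ∃ x, Y.IsWalk w l₁ x ∧ Y.IsWalk x l₂ w' := by
  induction l₁ with
  | nil => intro w w'; simp [IsWalk]
  | cons e l ih => intro w w'; simp [IsWalk, ih, and_assoc]

/-- The Frobenius automorphism does not depend on any choice. -/
theorem isFrobenius_unique (hY : Y.IsConnected) (p : X.PrimeClass) (g h : C.G)
    (hg : C.IsFrobenius p g) (hh : C.IsFrobenius p h) : g = h := by
  obtain ⟨l₁, l₁', w₁, h1, hp1, rfl, hw1⟩ := hg
  obtain ⟨l₂, l₂', w₂, h2, hp2, rfl, hw2⟩ := hh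
  obtain ⟨n, hn⟩ : List.IsRotated (l₁'.map C.π.onDart) (l₂'.map C.π.onDart) :=
    Cycle.coe_eq_coe.1 (hp1.trans hp2.symm)
  -- a lift of the second path, starting on the lift of the first one
  obtain ⟨l₃, x, hl₃, hx⟩ : ∃ (l₃ : List Y.Dart) (x : Y.V),
      l₃.map C.π.onDart = l₂'.map C.π.onDart ∧ Y.IsWalk x l₃ (C.π.act g x) := by
    set m := n % l₁'.length
    rw [← List.take_append_drop m l₁', isWalk_append] at hw1
    obtain ⟨x, ha, hb⟩ := hw1
    refine ⟨l₁'.drop m ++ (l₁'.take m).map g.1.2, x, ?_,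
      (isWalk_append _ _ _ _).2 ⟨_, hb, C.isWalk_act g _ _ _ ha⟩⟩
    rw [← hn, List.map_append, map_onDart_act, ← List.map_append, ← List.map_rotate,
      List.rotate_eq_drop_append_take_mod]
  have hfib : C.π.onV x = C.π.onV w₂ := by
    have hne : l₂' ≠ [] := by
      rintro rfl
      exact h2.1.1 rfl
    obtain ⟨e₂, t₂, rfl⟩ := List.exists_cons_of_ne_nil hne
    cases l₃ with
    | nil => simp at hl₃
    | cons e₃ t₃ =>
      simp only [List.map_cons, List.cons.injEq] at hl₃
      rw [← hx.1, ← hw2.1, ← C.π.src_onDart, ← C.π.src_onDart, hl₃.1]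
  obtain ⟨k, rfl⟩ := C.transitive x w₂ hfib
  have := (C.lift_unique (l₃.map k.1.2) l₂' (C.π.act k x) _ _
    (by rw [map_onDart_act, hl₃]) (C.isWalk_act k _ _ _ hx) hw2).2
  apply C.act_injective hY g h (C.π.act k x)
  rw [← this, ← act_mul, ← act_mul, C.comm]

/-- `L` is the Artin-Ihara `L`-function of the cover attached to `χ`: a meromorphic function on the
complex plane which for all sufficiently small `u` is given by the Euler product
`∏_p (1 - χ(Frob_p) u ^ ν(p))⁻¹`, the product being over all primes `p` of `X`. -/
def IsArtinIharaL (χ : C.G →* ℂˣ) (L : ℂ → ℂ) : Prop :=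
  MeromorphicOn L Set.univ ∧
    ∀ᶠ u in 𝓝 (0 : ℂ),
      HasProd (fun p : X.PrimeClass => (1 - (χ (C.frobenius p) : ℂ) * u ^ p.length)⁻¹) (L u)

open Classical in
/-- The matrix `A(σ)`, with respect to a choice `w` of a vertex in each fibre. -/
noncomputable def adjMatrix (w : X.V → Y.V) (σ : C.G) : Matrix X.V X.V ℂ :=
  Matrix.of fun i j =>
    if i = j ∧ σ = 1 then 2 * (Y.numLoops (w i) : ℂ)
    else (Y.numEdges (w i) (C.π.act σ (w j)) : ℂ)

/-- The matrix `A_χ = ∑_σ χ(σ) A(σ)`. -/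
noncomputable def twistedAdjMatrix [Finite Y.V] [Finite Y.Dart] (w : X.V → Y.V)
    (χ : C.G →* ℂˣ) : Matrix X.V X.V ℂ :=
  ∑ σ : C.G, (χ σ : ℂ) • C.adjMatrix w σ

end AbelianCover

end Multigraph

/-! The `L`-function is the reciprocal of an explicit determinant, and that determinant can be read
off at `u = 1`. Choosing a vertex of `Y` above each vertex of `X` gives every oriented edge a
voltage in `G`. The Frobenius of a prime is the product of the voltages along it (`frobenius_eq`),
so χ of it is a product of edge weights `θ e`, with `θ e * θ (inv e) = 1`.

Let `W` be the weighted non-backtracking edge matrix. The series `∑ tr(Wᵐ) uᵐ / m` is a sum over all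
words in the oriented edges. Each nonempty word is uniquely a power of a primitive word, and a
primitive word of length `m` has `m` distinct rotations; regrouping and exponentiating gives the
Euler product `det (1 - u W)⁻¹` (`hasProd_primitiveCycle`, `hasProd_primeClass`). Bass' argument
turns this determinant over edges into `(1 - u²)^(r - 1) det ((1 - u²) - u A_χ + u² D)`, with `r`
the cycle rank (`det_one_sub_smul_edgeMatrix`, `twistedAdjMatrix_eq`).

At `u = 1` the last determinant is `det (D - A_χ)`, and `1 - u² = -(1 + u)(u - 1)` supplies the zero
and the power of `-2`. The determinant is nonzero: a kernel vector is transported by the weights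
along edges, so it is invariant under all values of χ because `Y` is connected, which forces χ to be
trivial (`det_laplacian_ne_zero`). -/

namespace List

/-! ### Combinatorics of words: periods, powers and primitive roots. -/

variable {α : Type*}

/-- A nonempty word which is not a proper power. -/
def IsPrimitiveWord (l : List α) : Prop :=
  l ≠ [] ∧ ∀ (c : List α) (a : ℕ), 2 ≤ a → l ≠ (replicate a c).flatten

/-- Commutation makes `t` a prefix of the longer word `l`; after cancelling it, the remainder still
commutes with `t`. -/
theorem eq_flatten_replicate_of_append_comm (t : List α) (n : ℕ) : ∀ l : List α,
    l.length = n * t.length → t ++ l = l ++ t → l = (replicate n t).flatten := by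
  induction n with
  | zero => intro l hl _; simpa using hl
  | succ n ih =>
    intro l hl h
    obtain ⟨l', rfl⟩ : t <+: l := by
      refine prefix_of_prefix_length_le (prefix_append t l) (h ▸ prefix_append l t) ?_
      rw [hl]; exact Nat.le_mul_of_pos_left _ n.succ_pos
    have h' : t ++ l' = l' ++ t := by simpa using h
    rw [replicate_succ, flatten_cons, ← ih l' _ h']
    have : (n + 1) * t.length = t.length + n * t.length := by ring
    rw [length_append, this] at hl
    omega

theorem eq_flatten_replicate_of_rotate_eq {l : List α} {n g : ℕ} (hl : l.length = n * g)
    (h : l.rotate g = l) : l = (replicate n (l.take g)).flatten := by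
  cases n with
  | zero => simpa using hl
  | succ n =>
    have hg : g ≤ l.length := by rw [hl]; exact Nat.le_mul_of_pos_left _ n.succ_pos
    have hlen : (l.take g).length = g := by simpa using hg
    rw [rotate_eq_drop_append_take hg] at h
    have h2 : l.drop g = (replicate n (l.take g)).flatten := by
      apply eq_flatten_replicate_of_append_comm
      · rw [hlen, length_drop, hl, Nat.succ_mul]; omega
      · rw [h, take_append_drop]
    rw [replicate_succ, flatten_cons, ← h2, take_append_drop]

theorem iterate_rotate_one (l : List α) (n : ℕ) :
    (fun l : List α => l.rotate 1)^[n] l = l.rotate n := by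
  induction n generalizing l with
  | zero => simp
  | succ n ih => rw [Function.iterate_succ_apply, ih, rotate_rotate, Nat.add_comm]

/-- Rotation by one letter is a single map, and the periods of a point under iteration are closed
under gcd. -/
theorem rotate_gcd_eq {l : List α} {a b : ℕ} (ha : l.rotate a = l) (hb : l.rotate b = l) :
    l.rotate (a.gcd b) = l := by
  rw [← iterate_rotate_one] at *
  exact Function.IsPeriodicPt.gcd (f := fun l : List α => l.rotate 1) ha hb

theorem rotate_flatten_replicate (r : List α) (k : ℕ) :
    ((replicate k r).flatten).rotate r.length = (replicate k r).flatten := by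
  cases k with
  | zero => simp
  | succ k =>
    conv_lhs => rw [replicate_succ, flatten_cons, rotate_append_length_eq]
    rw [replicate_succ', flatten_append]
    simp

theorem flatten_replicate_mul (t : List α) (a b : ℕ) :
    (replicate (a * b) t).flatten = (replicate a (replicate b t).flatten).flatten := by
  induction a with
  | zero => simp
  | succ a ih =>
    rw [Nat.succ_mul, Nat.add_comm, replicate_add, flatten_append, ih, replicate_succ,
      flatten_cons]

theorem IsPrimitiveWord.eq_one {t : List α} {q : ℕ}
    (h : ((replicate q t).flatten).IsPrimitiveWord) : q = 1 := by
  have h2 : ¬ 2 ≤ q := fun h2 => h.2 t q h2 rfl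
  have h0 : q ≠ 0 := by rintro rfl; exact h.1 (by simp)
  omega

/-- The gcd of `d` and the length is again a period, which cuts `l` into equal blocks; primitivity
leaves only one block. -/
theorem IsPrimitiveWord.length_dvd {l : List α} (h : l.IsPrimitiveWord) {d : ℕ}
    (hd : l.rotate d = l) : l.length ∣ d := by
  have hg := rotate_gcd_eq hd l.rotate_length
  obtain ⟨n, hn⟩ := Nat.gcd_dvd_right d l.length
  rw [Nat.mul_comm] at hn
  have hl := eq_flatten_replicate_of_rotate_eq hn hg
  have h1 : n = 1 := by rw [hl] at h; exact h.eq_one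
  rw [h1, Nat.one_mul] at hn
  exact hn ▸ Nat.gcd_dvd_left d l.length

theorem IsPrimitiveWord.eq_take_of_rotate {r : List α} (hr : r.IsPrimitiveWord) {k g : ℕ}
    (hk : k ≠ 0) (hg : g ∣ r.length)
    (h : ((replicate k r).flatten).rotate g = (replicate k r).flatten) :
    r = ((replicate k r).flatten).take g := by
  obtain ⟨q, hq⟩ := hg
  rw [Nat.mul_comm] at hq
  set l := (replicate k r).flatten with hl
  have hlen : l.length = (k * q) * g := by simp [hl, hq, Nat.mul_assoc]
  have h1 := eq_flatten_replicate_of_rotate_eq hlen h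
  obtain ⟨k, rfl⟩ := Nat.exists_eq_succ_of_ne_zero hk
  have hgl : g ≤ l.length := by
    rw [hlen]
    rcases Nat.eq_zero_or_pos q with rfl | hq0
    · exact absurd (length_eq_zero_iff.1 (by simpa using hq)) hr.1
    · exact Nat.le_mul_of_pos_left _ (by positivity)
  have htl : (l.take g).length = g := by simpa using hgl
  have h2 : r ++ (replicate k r).flatten =
      (replicate q (l.take g)).flatten ++ (replicate (k * q) (l.take g)).flatten := by
    rw [← flatten_append, ← replicate_add, ← flatten_cons, ← replicate_succ, ← hl,
      show q + k * q = k.succ * q by rw [Nat.succ_mul, Nat.add_comm]]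
    exact h1
  have h3 := (append_inj h2 (by simp [hq, hgl])).1
  have hq1 : q = 1 := by rw [h3] at hr; exact hr.eq_one
  rw [hq1] at h3
  simpa using h3

/-- Both lengths are periods of the common power, hence so is their gcd, and primitivity identifies
`r` and `s` with the prefix of that length. -/
theorem IsPrimitiveWord.pow_inj {r s : List α} (hr : r.IsPrimitiveWord) (hs : s.IsPrimitiveWord)
    {k j : ℕ} (hk : k ≠ 0) (hj : j ≠ 0) (h : (replicate k r).flatten = (replicate j s).flatten) :
    r = s ∧ k = j := by
  have hg := rotate_gcd_eq (rotate_flatten_replicate r k)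
    (h ▸ rotate_flatten_replicate s j : ((replicate k r).flatten).rotate s.length = _)
  have h1 := hr.eq_take_of_rotate hk (Nat.gcd_dvd_left _ _) hg
  have h2 := hs.eq_take_of_rotate hj (Nat.gcd_dvd_right r.length _) (h ▸ hg)
  have hrs : r = s := by rw [h1, h2, h]; simp [← h2]
  refine ⟨hrs, ?_⟩
  have := congrArg length h
  subst hrs
  have h0 : 0 < r.length := length_pos_iff.2 hr.1
  simp only [length_flatten, map_replicate, sum_replicate_nat] at this
  exact Nat.eq_of_mul_eq_mul_right h0 this

theorem exists_isPrimitiveWord_pow (n : ℕ) : ∀ l : List α, l.length ≤ n → l ≠ [] →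
    ∃ (r : List α) (k : ℕ), r.IsPrimitiveWord ∧ l = (replicate (k + 1) r).flatten := by
  induction n with
  | zero => intro l hl h; exact absurd (length_eq_zero_iff.1 (by omega)) h
  | succ n ih =>
    intro l hl h
    by_cases hp : l.IsPrimitiveWord
    · exact ⟨l, 0, hp, by simp⟩
    · simp only [IsPrimitiveWord, not_and, not_forall, not_not] at hp
      obtain ⟨c, a, ha, rfl⟩ := hp h
      have hc : c ≠ [] := by rintro rfl; simp at h
      have hc' : 0 < c.length := length_pos_iff.2 hc
      have hlen : c.length ≤ n := by
        simp only [length_flatten, map_replicate, sum_replicate_nat] at hl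
        nlinarith
      obtain ⟨r, k, hr, rfl⟩ := ih c hlen hc
      refine ⟨r, a * (k + 1) - 1, hr, ?_⟩
      rw [Nat.sub_add_cancel (by nlinarith), flatten_replicate_mul]

/-- A decomposition `c ^ a` of the rotated word makes `c.length` a period of `l` too, so `l.length`
divides it, which is impossible for `2 ≤ a`. -/
theorem IsPrimitiveWord.rotate {l : List α} (h : l.IsPrimitiveWord) (n : ℕ) :
    (l.rotate n).IsPrimitiveWord := by
  refine ⟨by simpa using h.1, fun c a ha hc => ?_⟩
  have h1 : (l.rotate n).rotate c.length = l.rotate n := by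
    rw [hc, rotate_flatten_replicate]
  rw [rotate_rotate, Nat.add_comm, ← rotate_rotate, rotate_eq_rotate] at h1
  have h2 := h.length_dvd h1
  have h3 := congrArg length hc
  simp only [length_rotate, length_flatten, map_replicate, sum_replicate_nat] at h3
  have h4 : 0 < l.length := length_pos_iff.2 h.1
  have h5 : 0 < c.length := by
    rcases Nat.eq_zero_or_pos c.length with h | h
    · rw [h] at h3; omega
    · exact h
  have := Nat.le_of_dvd h5 h2
  nlinarith

/-- The words in the cyclic class of a primitive word are its rotations, all of them distinct. -/
theorem IsPrimitiveWord.card_isRotated {r : List α} (hr : r.IsPrimitiveWord) :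
    Nat.card {l : List α // l ~r r} = r.length := by
  rw [← Nat.card_fin r.length]
  symm
  refine Nat.card_congr (Equiv.ofBijective
    (fun i => ⟨r.rotate i, IsRotated.forall r i⟩) ⟨?_, ?_⟩)
  · have key : ∀ i j : Fin r.length, i ≤ j → r.rotate i = r.rotate j → i = j := by
      intro i j hij h
      obtain ⟨d, hd⟩ := Nat.exists_eq_add_of_le (Fin.le_def.1 hij)
      rw [hd, Nat.add_comm, ← rotate_rotate, rotate_eq_rotate] at h
      have := hr.length_dvd h.symm
      have hlt := j.2
      rcases Nat.eq_zero_or_pos d with h0 | h0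
      · exact Fin.ext (by omega)
      · have := Nat.le_of_dvd h0 this; omega
    intro i j h
    have h := congrArg Subtype.val h
    rcases le_total i j with hij | hij
    · exact key i j hij h
    · exact (key j i hij h.symm).symm
  · rintro ⟨l, hl⟩
    obtain ⟨n, rfl⟩ := hl.symm
    have h4 : 0 < r.length := length_pos_iff.2 hr.1
    exact ⟨⟨n % r.length, Nat.mod_lt _ h4⟩, Subtype.ext (by simp [rotate_mod])⟩

/-! ### Weights of words in the entries of a matrix. -/

/-- The product of the entries `W a c₁, W c₁ c₂, …, W cₙ b`. -/
def chainWeight (W : Matrix α α ℂ) : α → List α → α → ℂ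
  | a, [], b => W a b
  | a, c :: l, b => W a c * chainWeight W c l b

/-- The product of the entries of `W` along a cyclic word. -/
def cyclicWeight (W : Matrix α α ℂ) : List α → ℂ
  | [] => 1
  | a :: l => chainWeight W a l a

theorem chainWeight_append_cons (W : Matrix α α ℂ) (l : List α) (c : α) (l' : List α) :
    ∀ a b : α, chainWeight W a (l ++ c :: l') b = chainWeight W a l c * chainWeight W c l' b := by
  induction l with
  | nil => intro a b; rfl
  | cons d l ih => intro a b; simp [chainWeight, ih, mul_assoc]

theorem cyclicWeight_rotate (W : Matrix α α ℂ) (l : List α) (n : ℕ) :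
    cyclicWeight W (l.rotate n) = cyclicWeight W l := by
  induction n generalizing l with
  | zero => simp
  | succ n ih =>
    cases l with
    | nil => simp
    | cons a l =>
      rw [rotate_cons_succ, ih]
      cases l with
      | nil => rfl
      | cons b l =>
        simp only [cons_append, cyclicWeight, chainWeight, chainWeight_append_cons]
        exact mul_comm _ _

theorem chainWeight_pow (W : Matrix α α ℂ) (a : α) (l : List α) (k : ℕ) :
    cyclicWeight W (replicate (k + 1) (a :: l)).flatten = chainWeight W a l a ^ (k + 1) := by
  induction k with
  | zero => simp [cyclicWeight]
  | succ k ih =>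
    rw [pow_succ', ← ih, replicate_succ, replicate_succ]
    simp only [flatten_cons, cons_append, cyclicWeight, chainWeight_append_cons]

theorem cyclicWeight_pow (W : Matrix α α ℂ) (l : List α) (k : ℕ) :
    cyclicWeight W (replicate (k + 1) l).flatten = cyclicWeight W l ^ (k + 1) := by
  cases l with
  | nil => simp [cyclicWeight]
  | cons a l => exact chainWeight_pow W a l k

theorem norm_chainWeight_le {W : Matrix α α ℂ} {c : ℝ} (hc : ∀ a b, ‖W a b‖ ≤ c) (l : List α) :
    ∀ a b, ‖chainWeight W a l b‖ ≤ c ^ (l.length + 1) := by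
  induction l with
  | nil => intro a b; simpa [chainWeight] using hc a b
  | cons d l ih =>
    intro a b
    rw [chainWeight, norm_mul, length_cons, pow_succ' c]
    exact mul_le_mul (hc _ _) (ih _ _) (norm_nonneg _) ((norm_nonneg _).trans (hc a d))

theorem norm_cyclicWeight_le {W : Matrix α α ℂ} {c : ℝ} (hc : ∀ a b, ‖W a b‖ ≤ c) (l : List α) :
    ‖cyclicWeight W l‖ ≤ c ^ l.length := by
  cases l with
  | nil => simp [cyclicWeight]
  | cons a l => exact norm_chainWeight_le hc l a a

theorem sum_chainWeight [Fintype α] [DecidableEq α] (W : Matrix α α ℂ) (m : ℕ) : ∀ a b,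
    ∑ x : Fin m → α, chainWeight W a (ofFn x) b = (W ^ (m + 1)) a b := by
  induction m with
  | zero => intro a b; simp [chainWeight]
  | succ m ih =>
    intro a b
    rw [pow_succ' W, Matrix.mul_apply, ← (Fin.consEquiv fun _ => α).sum_comp,
      Fintype.sum_prod_type]
    refine Finset.sum_congr rfl fun c _ => ?_
    rw [← ih, Finset.mul_sum]
    refine Finset.sum_congr rfl fun x _ => ?_
    simp [Fin.consEquiv, chainWeight, ofFn_succ]

theorem sum_cyclicWeight [Fintype α] [DecidableEq α] (W : Matrix α α ℂ) (m : ℕ) :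
    ∑ x : Fin (m + 1) → α, cyclicWeight W (ofFn x) = (W ^ (m + 1)).trace := by
  rw [← (Fin.consEquiv fun _ => α).sum_comp, Fintype.sum_prod_type, Matrix.trace]
  refine Finset.sum_congr rfl fun c _ => ?_
  rw [Matrix.diag, ← sum_chainWeight]
  simp [Fin.consEquiv, cyclicWeight, ofFn_succ]

/-- Grouping words by length gives a geometric series of ratio `Fintype.card α * x`. -/
theorem summable_pow_length [Fintype α] {x : ℝ} (hx : 0 ≤ x) (h : Fintype.card α * x < 1) :
    Summable fun l : List α => x ^ l.length := by
  rw [← equivSigmaTuple.symm.summable_iff]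
  refine (summable_sigma_of_nonneg fun y => by simpa using pow_nonneg hx y.1).2 ⟨fun m => Summable.of_finite, ?_⟩
  refine (summable_geometric_of_lt_one (by positivity) h).congr fun m => ?_
  simp [equivSigmaTuple, tsum_fintype, mul_pow]

end List

/-! ### Traces of powers and determinants through eigenvalues. -/

section Spectral

open Polynomial

variable {n : Type*} [Fintype n] [DecidableEq n]

theorem Matrix.card_roots_charpoly (W : Matrix n n ℂ) :
    W.charpoly.roots.card = Fintype.card n := by
  rw [← (IsAlgClosed.splits W.charpoly).natDegree_eq_card_roots, Matrix.charpoly_natDegree_eq_dim]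

theorem Matrix.det_sub_scalar (W : Matrix n n ℂ) (z : ℂ) :
    (W - Matrix.scalar n z).det = (W.charpoly.roots.map fun r => r - z).prod := by
  have h2 := (IsAlgClosed.splits W.charpoly).eval_eq_prod_roots_of_monic W.charpoly_monic z
  rw [Matrix.eval_charpoly] at h2
  have h3 : (fun r => r - z) = fun r : ℂ => -1 * (z - r) := by funext r; ring
  rw [← neg_sub, Matrix.det_neg, h2, h3, Multiset.prod_map_mul, Multiset.map_const',
    Multiset.prod_replicate, W.card_roots_charpoly]

/-- The determinant of `p(W)` in terms of the eigenvalues of `W`. -/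
theorem Matrix.det_aeval_eq_prod_roots (W : Matrix n n ℂ) (p : ℂ[X]) :
    (aeval W p).det = (W.charpoly.roots.map fun r => p.eval r).prod := by
  -- Both sides are multiplicative in `p`, so it suffices to treat constants and linear factors.
  rw [(IsAlgClosed.splits p).eq_prod_roots]
  generalize p.leadingCoeff = a
  generalize p.roots = s
  induction s using Multiset.induction_on with
  | empty =>
    simp [Matrix.algebraMap_eq_diagonal, W.card_roots_charpoly]
  | cons μ s ih =>
    have h : C a * ((μ ::ₘ s).map fun x => X - C x).prod =
        (X - C μ) * (C a * (s.map fun x => X - C x).prod) := by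
      rw [Multiset.map_cons, Multiset.prod_cons]; ring
    rw [h, map_mul, Matrix.det_mul, ih]
    simp only [eval_mul (p := X - C μ), Multiset.prod_map_mul]
    congr 1
    rw [map_sub, aeval_X, aeval_C]
    simpa [Matrix.algebraMap_eq_diagonal, Pi.algebraMap_def] using W.det_sub_scalar μ

/-- Evaluating the determinant of `z - W ^ m` as a polynomial in `W` shows that the eigenvalues of
`W ^ m`, with multiplicity, are the `m`-th powers of those of `W`. -/
theorem Matrix.trace_pow_eq_sum_roots (W : Matrix n n ℂ) (m : ℕ) :
    (W ^ m).trace = (W.charpoly.roots.map (· ^ m)).sum := by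
  have h : (W ^ m).charpoly = ((W.charpoly.roots.map (· ^ m)).map fun r => X - C r).prod := by
    refine Polynomial.funext fun z => ?_
    have h1 := W.det_aeval_eq_prod_roots (C z - X ^ m)
    rw [Matrix.eval_charpoly, eval_multiset_prod, Multiset.map_map, Multiset.map_map]
    simpa [Matrix.algebraMap_eq_diagonal, Pi.algebraMap_def, Function.comp_def] using h1
  rw [Matrix.trace_eq_sum_roots_charpoly, h, roots_multiset_prod_X_sub_C]

theorem Matrix.det_one_sub_smul_eq_prod_roots (W : Matrix n n ℂ) (u : ℂ) :
    (1 - u • W).det = (W.charpoly.roots.map fun r => 1 - u * r).prod := by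
  have h1 := W.det_aeval_eq_prod_roots (1 - C u * X)
  simpa [Algebra.smul_def] using h1

theorem hasSum_multiset_neg_log (u : ℂ) (s : Multiset ℂ) (h : ∀ r ∈ s, ‖u * r‖ < 1) :
    HasSum (fun m : ℕ => u ^ m * (s.map (· ^ m)).sum / m)
      (s.map fun r => -Complex.log (1 - u * r)).sum := by
  induction s using Multiset.induction_on with
  | empty => simp
  | cons r s ih =>
    have h1 := Complex.hasSum_taylorSeries_neg_log (h r (Multiset.mem_cons_self r s))
    have h2 := h1.add (ih fun x hx => h x (Multiset.mem_cons_of_mem hx))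
    simp only [Multiset.map_cons, Multiset.sum_cons]
    refine h2.congr_fun fun m => ?_
    rw [mul_pow]; ring

theorem exp_multiset_neg_log (u : ℂ) (s : Multiset ℂ) (h : ∀ r ∈ s, ‖u * r‖ < 1) :
    Complex.exp (s.map fun r => -Complex.log (1 - u * r)).sum =
      ((s.map fun r => 1 - u * r).prod)⁻¹ := by
  induction s using Multiset.induction_on with
  | empty => simp
  | cons r s ih =>
    have h1 := h r (Multiset.mem_cons_self r s)
    have h0 : 1 - u * r ≠ 0 := by
      intro h0
      rw [← sub_eq_zero.1 h0] at h1
      simp at h1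
    simp only [Multiset.map_cons, Multiset.sum_cons, Multiset.prod_cons]
    rw [Complex.exp_add, ih fun x hx => h x (Multiset.mem_cons_of_mem hx), Complex.exp_neg,
      Complex.exp_log h0, mul_inv]

/-- `exp (∑ₘ tr(Wᵐ) uᵐ / m) = det (1 - u W)⁻¹`. -/
theorem Matrix.exists_hasSum_trace_pow (W : Matrix n n ℂ) : ∀ᶠ u : ℂ in 𝓝 0,
    ∃ S : ℂ, HasSum (fun m : ℕ => u ^ m * (W ^ m).trace / m) S ∧
      Complex.exp S = ((1 - u • W).det)⁻¹ := by
  have h : ∀ᶠ u : ℂ in 𝓝 0, ∀ r ∈ W.charpoly.roots.toFinset, ‖u * r‖ < 1 := by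
    refine (Finset.eventually_all _).2 fun r _ => ?_
    have : Tendsto (fun u : ℂ => ‖u * r‖) (𝓝 0) (𝓝 0) := by
      have : Continuous fun u : ℂ => ‖u * r‖ := by fun_prop
      simpa using this.tendsto 0
    exact this.eventually_lt_const one_pos
  filter_upwards [h] with u hu
  simp only [Multiset.mem_toFinset] at hu
  refine ⟨_, ?_, (exp_multiset_neg_log u _ hu).trans (by rw [W.det_one_sub_smul_eq_prod_roots])⟩
  simpa only [W.trace_pow_eq_sum_roots] using hasSum_multiset_neg_log u _ hu

end Spectral

/-! ### From the trace series to the Euler product. -/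

section EulerProduct

namespace List

variable {α : Type*}

/-- The cyclic class of a primitive `r` contains exactly `r.length` words with equal terms, so the
division by the length counts each class once. -/
theorem hasSum_primitiveCycle {φ : List α → ℂ} {ψ : Cycle α → ℂ} (hφ : ∀ l : List α, ψ l = φ l)
    {S : ℂ} (h : HasSum (fun r : {l : List α // l.IsPrimitiveWord} => φ r / r.1.length) S) :
    HasSum (fun c : {c : Cycle α // ∃ l : List α, l.IsPrimitiveWord ∧ (l : Cycle α) = c} =>
      ψ c.1) S := by
  let g : {l : List α // l.IsPrimitiveWord} →
      {c : Cycle α // ∃ l : List α, l.IsPrimitiveWord ∧ (l : Cycle α) = c} :=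
    fun l => ⟨l.1, l.1, l.2, rfl⟩
  refine HasSum.sigma ((Equiv.sigmaFiberEquiv g).hasSum_iff.2 h) ?_
  rintro ⟨c, r, hr, rfl⟩
  let e : {l : {l : List α // l.IsPrimitiveWord} // g l = ⟨(r : Cycle α), r, hr, rfl⟩} ≃
      {l : List α // l ~r r} :=
    { toFun := fun l => ⟨l.1.1, Cycle.coe_eq_coe.1 (congrArg Subtype.val l.2)⟩
      invFun := fun l => ⟨⟨l.1, by
        obtain ⟨n, hn⟩ := l.2.symm
        exact hn ▸ hr.rotate n⟩, Subtype.ext (Cycle.coe_eq_coe.2 l.2)⟩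
      left_inv := fun _ => rfl
      right_inv := fun _ => rfl }
  have hcard := hr.card_isRotated
  have hlen : 0 < r.length := length_pos_iff.2 hr.1
  have : Finite {l : List α // l ~r r} := Nat.finite_of_card_ne_zero (by omega)
  have := Fintype.ofFinite {l : List α // l ~r r}
  rw [← e.symm.hasSum_iff]
  have hval : ∀ l : {l : List α // l ~r r}, φ l.1 / l.1.length = ψ r / r.length := by
    intro l
    rw [← hφ, Cycle.coe_eq_coe.2 l.2, l.2.perm.length_eq]
  have h1 := hasSum_fintype fun l : {l : List α // l ~r r} => φ l.1 / l.1.length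
  rw [Fintype.sum_congr _ _ hval, Finset.sum_const, Finset.card_univ, ← Nat.card_eq_fintype_card,
    hcard, nsmul_eq_mul, mul_div_cancel₀ _ (by exact_mod_cast hlen.ne')] at h1
  exact h1

/-- The Euler product over the primitive cyclic words attached to a matrix. -/
theorem hasProd_primitiveCycle [Fintype α] [DecidableEq α] (W : Matrix α α ℂ) {ω : Cycle α → ℂ}
    (hω : ∀ l : List α, ω l = cyclicWeight W l) : ∀ᶠ u : ℂ in 𝓝 0,
    HasProd (fun c : {c : Cycle α // ∃ l : List α, l.IsPrimitiveWord ∧ (l : Cycle α) = c} =>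
      (1 - ω c.1 * u ^ c.1.length)⁻¹) ((1 - u • W).det)⁻¹ := by
  obtain ⟨c, hc0, hc⟩ : ∃ c : ℝ, 0 < c ∧ ∀ a b, ‖W a b‖ ≤ c := by
    obtain ⟨c, hc⟩ := (Set.finite_range fun x : α × α => ‖W x.1 x.2‖).bddAbove
    exact ⟨max c 1, by positivity, fun a b => (hc ⟨(a, b), rfl⟩).trans (le_max_left _ _)⟩
  have hsmall : ∀ᶠ u : ℂ in 𝓝 0, c * ‖u‖ < 1 ∧ Fintype.card α * (c * ‖u‖) < 1 := by
    have h1 : Tendsto (fun u : ℂ => c * ‖u‖) (𝓝 0) (𝓝 0) := by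
      have : Continuous fun u : ℂ => c * ‖u‖ := by fun_prop
      simpa using this.tendsto 0
    have h2 : Tendsto (fun u : ℂ => Fintype.card α * (c * ‖u‖)) (𝓝 0) (𝓝 0) := by
      simpa using h1.const_mul (Fintype.card α : ℝ)
    exact (h1.eventually_lt_const one_pos).and (h2.eventually_lt_const one_pos)
  filter_upwards [hsmall, W.exists_hasSum_trace_pow] with u ⟨hu1, hu2⟩ ⟨S, hS, hexp⟩
  have hbound : ∀ l : List α, ‖cyclicWeight W l * u ^ l.length‖ ≤ (c * ‖u‖) ^ l.length := by
    intro l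
    rw [norm_mul, norm_pow, mul_pow]
    gcongr
    exact norm_cyclicWeight_le hc l
  -- Division by zero makes `F []` vanish, matching the `m = 0` term of the trace series.
  let F : List α → ℂ := fun l => cyclicWeight W l * u ^ l.length / l.length
  have hF : HasSum F S := by
    have hs : Summable F := by
      refine Summable.of_norm_bounded (summable_pow_length (by positivity) hu2) fun l => ?_
      rw [norm_div, Complex.norm_natCast]
      rcases Nat.eq_zero_or_pos l.length with h0 | h0
      · simp [h0]
      · exact (div_le_self (norm_nonneg _) (by exact_mod_cast h0)).trans (hbound l)
    have h1 := hs.hasSum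
    rw [← equivSigmaTuple.symm.hasSum_iff] at h1
    have h2 := h1.sigma fun m => hasSum_fintype _
    have h3 : tsum F = S := by
      refine h2.unique (hS.congr_fun fun m => ?_)
      cases m with
      | zero => simp [F]
      | succ m =>
        simp only [F, equivSigmaTuple, Equiv.coe_fn_symm_mk, Function.comp_apply, length_ofFn]
        rw [← Finset.sum_div, ← Finset.sum_mul, sum_cyclicWeight, mul_comm]
    exact h3 ▸ hs.hasSum
  -- Unique primitive roots reindex the nonempty words; the empty word is the only one missed, and
  -- `F` vanishes there.
  have hpow : HasSum (fun x : {l : List α // l.IsPrimitiveWord} × ℕ =>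
      F (replicate (x.2 + 1) x.1.1).flatten) S := by
    refine (Function.Injective.hasSum_iff (f := F) (g := fun x :
      {l : List α // l.IsPrimitiveWord} × ℕ => (replicate (x.2 + 1) x.1.1).flatten) ?_ ?_).2 hF
    · rintro ⟨⟨r, hr⟩, k⟩ ⟨⟨s, hs⟩, j⟩ h
      obtain ⟨rfl, h2⟩ := hr.pow_inj hs k.succ_ne_zero j.succ_ne_zero h
      simpa using h2
    · intro l hl
      rcases eq_or_ne l [] with rfl | h0
      · simp [F]
      · obtain ⟨r, k, hr, rfl⟩ := exists_isPrimitiveWord_pow _ l le_rfl h0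
        exact absurd ⟨(⟨r, hr⟩, k), rfl⟩ hl
  have hlt : ∀ r : List α, r.IsPrimitiveWord → ‖cyclicWeight W r * u ^ r.length‖ < 1 :=
    fun r hr => (hbound r).trans_lt
      (pow_lt_one₀ (by positivity) hu1 (length_pos_iff.2 hr.1).ne')
  -- For fixed `r`, the powers of `r` sum to a logarithmic series; the factor `1 / r.length` remains
  -- because `r ^ (k + 1)` has length `(k + 1) * r.length`.
  have hlog : HasSum (fun r : {l : List α // l.IsPrimitiveWord} =>
      (-Complex.log (1 - cyclicWeight W r * u ^ r.1.length)) / r.1.length) S := by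
    refine hpow.prod_fiberwise fun r => ?_
    have h1 := (Complex.hasSum_taylorSeries_neg_log' (hlt r.1 r.2)).div_const (r.1.length : ℂ)
    refine h1.congr_fun fun k => ?_
    simp only [F, cyclicWeight_pow, length_flatten, map_replicate, sum_replicate_nat]
    rw [mul_pow, ← pow_mul, mul_comm r.1.length, div_div]
    push_cast
    rfl
  have hcyc := hasSum_primitiveCycle (ψ := fun c => -Complex.log (1 - ω c * u ^ c.length))
    (φ := fun l => -Complex.log (1 - cyclicWeight W l * u ^ l.length))
    (fun l => by simp [hω]) hlog
  rw [← hexp]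
  convert hcyc.cexp using 1
  funext ⟨c, r, hr, hrc⟩
  subst hrc
  have h0 : 1 - cyclicWeight W r * u ^ r.length ≠ 0 := by
    intro h0
    have := hlt r hr
    rw [← sub_eq_zero.1 h0] at this
    simp at this
  simp [hω, Complex.exp_neg, Complex.exp_log h0]

end List

end EulerProduct

/-! ### Counting edges through their two orientations. -/

namespace Multigraph

variable (X : Multigraph.{u₁, v₁})

/-- A choice of orientation of each edge. -/
noncomputable def orient (q : X.Edge) : X.Dart := Quotient.out (s := X.edgeSetoid) q

/-- The edge underlying an oriented edge. -/
def toEdge (e : X.Dart) : X.Edge := Quotient.mk X.edgeSetoid e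

theorem toEdge_orient (q : X.Edge) : X.toEdge (X.orient q) = q := Quotient.out_eq q

theorem toEdge_eq_iff {a b : X.Dart} : X.toEdge a = X.toEdge b ↔ a = b ∨ a = X.inv b :=
  Quotient.eq (r := X.edgeSetoid)

theorem toEdge_inv (e : X.Dart) : X.toEdge (X.inv e) = X.toEdge e :=
  X.toEdge_eq_iff.2 (Or.inr rfl)

theorem inv_injective : Function.Injective X.inv :=
  Function.LeftInverse.injective X.inv_inv

theorem tgt_inv (e : X.Dart) : X.tgt (X.inv e) = X.src e := by simp [tgt, X.inv_inv]

theorem src_inv (e : X.Dart) : X.src (X.inv e) = X.tgt e := rfl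

theorem ends_eq (q : X.Edge) : X.ends q = s(X.src (X.orient q), X.tgt (X.orient q)) := by
  conv_lhs => rw [← X.toEdge_orient q]
  rfl

/-- Every edge has two orientations. -/
noncomputable def edgeSumEquiv : X.Edge ⊕ X.Edge ≃ X.Dart :=
  Equiv.ofBijective (Sum.elim X.orient fun q => X.inv (X.orient q)) (by
    constructor
    · rintro (a | a) (b | b) h
      all_goals
        have h' := congrArg X.toEdge h
        simp only [Sum.elim_inl, Sum.elim_inr, toEdge_inv, toEdge_orient] at h'
        subst h'
      · rfl
      · exact absurd h.symm (X.inv_ne _)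
      · exact absurd h (X.inv_ne _)
      · rfl
    · intro e
      rcases X.toEdge_eq_iff.1 (X.toEdge_orient (X.toEdge e)) with h | h
      · exact ⟨Sum.inl (X.toEdge e), h⟩
      · exact ⟨Sum.inr (X.toEdge e), by simp [h, X.inv_inv]⟩)

@[simp] theorem edgeSumEquiv_inl (q : X.Edge) : X.edgeSumEquiv (Sum.inl q) = X.orient q := rfl

@[simp] theorem edgeSumEquiv_inr (q : X.Edge) :
    X.edgeSumEquiv (Sum.inr q) = X.inv (X.orient q) := rfl

theorem sum_dart [Fintype X.Dart] [Fintype X.Edge] {M : Type*} [AddCommMonoid M]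
    (f : X.Dart → M) : ∑ e, f e = ∑ q, (f (X.orient q) + f (X.inv (X.orient q))) := by
  rw [← X.edgeSumEquiv.sum_comp, Fintype.sum_sum_type, Finset.sum_add_distrib]
  rfl

theorem natCard_subtype_eq_sum {ι : Type*} [Fintype ι] (p : ι → Prop) [DecidablePred p] :
    Nat.card {x // p x} = ∑ x, if p x then 1 else 0 := by
  rw [Nat.card_eq_fintype_card, Fintype.card_subtype, Finset.card_filter]

open Classical in
-- Both orientations of a loop leave `v`, which accounts for its being counted twice.
theorem degree_eq_sum [Fintype X.Dart] (v : X.V) :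
    X.degree v = ∑ e : X.Dart, if X.src e = v then 1 else 0 := by
  have := Fintype.ofFinite X.Edge
  rw [degree, numLoops, numEdges, natCard_subtype_eq_sum, natCard_subtype_eq_sum, X.sum_dart,
    ← Finset.sum_add_distrib]
  refine Finset.sum_congr rfl fun q _ => ?_
  rw [X.ends_eq, src_inv]
  by_cases h1 : X.src (X.orient q) = v <;> by_cases h2 : X.tgt (X.orient q) = v <;>
    simp [h1, h2, eq_comm (a := v)]

open Classical in
theorem numEdges_eq_sum [Fintype X.Dart] {v w : X.V} (h : v ≠ w) :
    X.numEdges v w = ∑ e : X.Dart, if X.src e = v ∧ X.tgt e = w then 1 else 0 := by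
  have := Fintype.ofFinite X.Edge
  rw [numEdges, natCard_subtype_eq_sum, X.sum_dart]
  refine Finset.sum_congr rfl fun q _ => ?_
  simp only [X.ends_eq, src_inv, tgt_inv, Sym2.eq_iff]
  by_cases h1 : X.src (X.orient q) = v <;> by_cases h2 : X.tgt (X.orient q) = v <;>
    by_cases h3 : X.src (X.orient q) = w <;> by_cases h4 : X.tgt (X.orient q) = w <;>
    simp_all

open Classical in
theorem two_mul_numLoops_eq_sum [Fintype X.Dart] (v : X.V) :
    2 * X.numLoops v = ∑ e : X.Dart, if X.src e = v ∧ X.tgt e = v then 1 else 0 := by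
  have := Fintype.ofFinite X.Edge
  rw [numLoops, numEdges, natCard_subtype_eq_sum, X.sum_dart, Finset.mul_sum]
  refine Finset.sum_congr rfl fun q _ => ?_
  simp only [X.ends_eq, src_inv, tgt_inv, Sym2.eq_iff]
  by_cases h1 : X.src (X.orient q) = v <;> by_cases h2 : X.tgt (X.orient q) = v <;>
    simp [h1, h2]

/-! ### Bass' determinant formula with edge weights. -/

section Bass

variable (θ : X.Dart → ℂ)

/-- The edge matrix, weighted by a function on the oriented edges. -/
def edgeMatrix [DecidableEq X.V] [DecidableEq X.Dart] : Matrix X.Dart X.Dart ℂ :=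
  Matrix.of fun e f => if X.tgt e = X.src f ∧ f ≠ X.inv e then θ e else 0

/-- The vertex adjacency matrix, weighted by a function on the oriented edges. -/
def weightedAdj [DecidableEq X.V] [Fintype X.Dart] : Matrix X.V X.V ℂ :=
  Matrix.of fun v w => ∑ e : X.Dart, if X.src e = v ∧ X.tgt e = w then θ e else 0

/-- The matrix `S` of initial vertices in Bass' proof. -/
def srcMatrix [DecidableEq X.V] : Matrix X.V X.Dart ℂ :=
  Matrix.of fun v e => if X.src e = v then 1 else 0

/-- The weighted matrix of terminal vertices. -/
def tgtMatrix [DecidableEq X.V] : Matrix X.Dart X.V ℂ :=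
  Matrix.of fun e v => if X.tgt e = v then θ e else 0

/-- The weighted matrix of the inversion of the oriented edges. -/
def invMatrix [DecidableEq X.Dart] : Matrix X.Dart X.Dart ℂ :=
  Matrix.of fun e f => if f = X.inv e then θ e else 0

/-- The product allows every continuation from the end of `e`; the inverse of `e` is always among
them, and the subtracted matrix removes exactly that one. -/
theorem edgeMatrix_eq [DecidableEq X.V] [DecidableEq X.Dart] [Fintype X.V] :
    X.edgeMatrix θ = X.tgtMatrix θ * X.srcMatrix - X.invMatrix θ := by
  ext e f
  have : X.src (X.inv e) = X.tgt e := rfl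
  by_cases h1 : f = X.inv e
  · simp [edgeMatrix, tgtMatrix, srcMatrix, invMatrix, Matrix.mul_apply, h1, this]
  · simp [edgeMatrix, tgtMatrix, srcMatrix, invMatrix, Matrix.mul_apply, h1, eq_comm]

variable [Fintype X.Dart]

theorem srcMatrix_mul_tgtMatrix [DecidableEq X.V] : X.srcMatrix * X.tgtMatrix θ = X.weightedAdj θ := by
  ext v w
  rw [Matrix.mul_apply]
  refine Finset.sum_congr rfl fun e _ => ?_
  simp only [srcMatrix, tgtMatrix, Matrix.of_apply]
  split_ifs <;> simp_all

theorem invMatrix_mul_apply [DecidableEq X.Dart] {ι : Type*} (M : Matrix X.Dart ι ℂ) (e : X.Dart)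
    (i : ι) :
    (X.invMatrix θ * M) e i = θ e * M (X.inv e) i := by
  rw [Matrix.mul_apply, Finset.sum_eq_single (X.inv e)]
  · simp [invMatrix]
  · intro f _ hf
    simp [invMatrix, hf]
  · simp

variable {θ}

theorem invMatrix_mul_self [DecidableEq X.Dart] (hθ : ∀ e, θ e * θ (X.inv e) = 1) :
    X.invMatrix θ * X.invMatrix θ = 1 := by
  ext e f
  rw [invMatrix_mul_apply]
  by_cases h : f = e
  · subst h
    simp [invMatrix, X.inv_inv, hθ]
  · simp [invMatrix, X.inv_inv, h, Ne.symm h]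

/-- Going along an edge and back cancels its weight and returns to the start, so only the count of
edges leaving each vertex survives. -/
theorem srcMatrix_mul_invMatrix_mul_tgtMatrix [DecidableEq X.V] [DecidableEq X.Dart]
    (hθ : ∀ e, θ e * θ (X.inv e) = 1) :
    X.srcMatrix * (X.invMatrix θ * X.tgtMatrix θ) = X.degreeMatrix := by
  ext v w
  have h : ∀ e, (X.invMatrix θ * X.tgtMatrix θ) e w = if X.src e = w then 1 else 0 := by
    intro e
    rw [invMatrix_mul_apply]
    simp [tgtMatrix, tgt_inv, hθ]
  rw [Matrix.mul_apply]
  simp only [h, degreeMatrix, Matrix.diagonal_apply, srcMatrix, Matrix.of_apply]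
  by_cases hvw : v = w
  · subst hvw
    simp only [if_true, X.degree_eq_sum, Nat.cast_sum]
    refine Finset.sum_congr rfl fun e _ => ?_
    split_ifs <;> simp
  · simp only [hvw, if_false]
    refine Finset.sum_eq_zero fun e _ => ?_
    by_cases h1 : X.src e = v
    · simp [h1, hvw]
    · simp [h1]

/-- Pairing each edge with its inverse splits the matrix into two-by-two blocks of determinant `1 -
u ^ 2`. -/
theorem det_one_add_smul_invMatrix [DecidableEq X.Dart] (hθ : ∀ e, θ e * θ (X.inv e) = 1) (u : ℂ) :
    (1 + u • X.invMatrix θ).det = (1 - u ^ 2) ^ Nat.card X.Edge := by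
  classical
  have := Fintype.ofFinite X.Edge
  have h : (1 + u • X.invMatrix θ).submatrix X.edgeSumEquiv X.edgeSumEquiv =
      Matrix.fromBlocks 1 (Matrix.diagonal fun q => u * θ (X.orient q))
        (Matrix.diagonal fun q => u * θ (X.inv (X.orient q))) 1 := by
    have hne : ∀ q q', X.orient q ≠ X.inv (X.orient q') := by
      intro q q' h
      have h' := congrArg X.toEdge h
      simp only [toEdge_inv, toEdge_orient] at h'
      subst h'
      exact X.inv_ne _ h.symm
    have hinj : ∀ q q', X.orient q = X.orient q' ↔ q = q' := fun q q' =>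
      ⟨fun h => by simpa [toEdge_orient] using congrArg X.toEdge h, fun h => h ▸ rfl⟩
    ext (a | a) (b | b)
    · simp [Matrix.one_apply, invMatrix, hne, hinj]
    · by_cases hab : a = b
      · simp [invMatrix, hne, hab]
      · simp [invMatrix, hne, hab, X.inv_injective.eq_iff, hinj, eq_comm]
    · by_cases hab : a = b
      · simp [invMatrix, (hne _ _).symm, hab, X.inv_inv]
      · simp [invMatrix, (hne _ _).symm, hab, X.inv_inv, hinj, eq_comm]
    · simp [Matrix.one_apply, invMatrix, (hne _ _).symm, X.inv_inv, hinj, X.inv_injective.eq_iff]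
  rw [← Matrix.det_submatrix_equiv_self X.edgeSumEquiv, h, Matrix.det_fromBlocks_one₁₁,
    Matrix.diagonal_mul_diagonal, ← Matrix.diagonal_one, Matrix.diagonal_sub, Matrix.det_diagonal]
  rw [Nat.card_eq_fintype_card, ← Finset.card_univ, ← Finset.prod_const]
  refine Finset.prod_congr rfl fun q _ => ?_
  linear_combination (-u ^ 2) * hθ (X.orient q)

/-- Bass' determinant formula. -/
theorem det_one_sub_smul_edgeMatrix [DecidableEq X.V] [DecidableEq X.Dart] [Fintype X.V]
    (hθ : ∀ e, θ e * θ (X.inv e) = 1) {u : ℂ} (hu : 1 - u ^ 2 ≠ 0) :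
    (1 - u • X.edgeMatrix θ).det = (1 - u ^ 2) ^ ((Nat.card X.Edge : ℤ) - Nat.card X.V) *
      ((1 - u ^ 2) • (1 : Matrix X.V X.V ℂ) - u • X.weightedAdj θ + u ^ 2 • X.degreeMatrix).det := by
  set c := 1 - u ^ 2 with hc
  set J := X.invMatrix θ
  set T := X.tgtMatrix θ
  set S := X.srcMatrix
  have hJ : J * J = 1 := X.invMatrix_mul_self hθ
  have h1 : (1 + u • J) * (1 - u • J) = c • 1 := by
    rw [add_mul, mul_sub, mul_sub, one_mul, one_mul, mul_one, smul_mul_smul_comm, hJ, hc, sub_smul,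
      one_smul, sq]
    abel
  -- Since `J` is an involution, `c⁻¹ • (1 - u • J)` inverts `1 + u • J`, which can therefore be
  -- factored out.
  have h2 : 1 - u • X.edgeMatrix θ =
      (1 + u • J) * (1 - ((c⁻¹ * u) • ((1 - u • J) * T)) * S) := by
    rw [mul_sub, mul_one, Matrix.smul_mul, Matrix.mul_smul, Matrix.mul_assoc, ← Matrix.mul_assoc,
      h1, Matrix.smul_mul, Matrix.one_mul, smul_smul, mul_assoc, mul_comm u c,
      inv_mul_cancel_left₀ hu, X.edgeMatrix_eq, smul_sub]
    abel
  -- Exchanging the factors in `det (1 - A * B)` passes from oriented edges to vertices, where `S *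
  -- T` is the adjacency matrix and `S * (J * T)` the degree matrix.
  have h3 : 1 - S * ((c⁻¹ * u) • ((1 - u • J) * T)) =
      c⁻¹ • (c • (1 : Matrix X.V X.V ℂ) - u • X.weightedAdj θ + u ^ 2 • X.degreeMatrix) := by
    rw [← X.srcMatrix_mul_tgtMatrix, ← X.srcMatrix_mul_invMatrix_mul_tgtMatrix hθ, smul_add,
      smul_sub, smul_smul, inv_mul_cancel₀ hu, one_smul, Matrix.mul_smul, Matrix.sub_mul,
      Matrix.mul_sub, Matrix.one_mul, Matrix.smul_mul, Matrix.mul_smul, smul_sub, smul_smul,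
      smul_smul, smul_smul, sq, mul_assoc, sub_sub_eq_add_sub]
    abel
  rw [h2, Matrix.det_mul, Matrix.det_one_sub_mul_comm, h3, Matrix.det_smul,
    X.det_one_add_smul_invMatrix hθ, ← hc, zpow_sub₀ hu, zpow_natCast, zpow_natCast,
    Nat.card_eq_fintype_card (α := X.V), inv_pow]
  ring

end Bass

end Multigraph

/-! ### Prime paths as primitive cyclic words. -/

namespace Multigraph

section Words

variable (X : Multigraph.{u₁, v₁}) {θ : X.Dart → ℂ}

theorem isChain_iff_isWalk (b : X.Dart) (l : List X.Dart) : ∀ a : X.Dart,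
    List.IsChain (fun e f => X.tgt e = X.src f ∧ f ≠ X.inv e) (a :: (l ++ [b])) ↔
      X.IsWalk (X.src a) (a :: l) (X.src b) ∧ X.NoBacktrack (a :: (l ++ [b])) := by
  induction l with
  | nil => intro a; simp [IsWalk, NoBacktrack]
  | cons c l ih =>
    intro a
    rw [List.cons_append, List.isChain_cons_cons, ih, NoBacktrack, NoBacktrack,
      List.isChain_cons_cons]
    simp only [IsWalk, true_and]
    constructor
    · rintro ⟨⟨h1, h2⟩, h3, h4⟩
      exact ⟨⟨h1.symm, h3⟩, h2, h4⟩
    · rintro ⟨⟨h1, h3⟩, h2, h4⟩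
      exact ⟨⟨h1.symm, h2⟩, h3, h4⟩

/-- Repeating the first edge at the end turns the absence of a tail into one more backtracking
condition. -/
theorem noBacktrack_append_head_iff (a : X.Dart) (l : List X.Dart) :
    X.NoBacktrack (a :: (l ++ [a])) ↔ X.NoBacktrack (a :: l) ∧ X.NoTail (a :: l) := by
  rw [← List.cons_append, NoBacktrack, List.isChain_append]
  simp [NoTail, NoBacktrack]

/-- Prime paths only exclude powers of closed paths, primitive words exclude all powers. These
agree: a root of a closed path is itself closed, since its second copy starts where the first one
ends. -/
theorem isPrimePath_iff (a : X.Dart) (l : List X.Dart) : X.IsPrimePath (a :: l) ↔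
    (a :: l).IsPrimitiveWord ∧
      List.IsChain (fun e f => X.tgt e = X.src f ∧ f ≠ X.inv e) (a :: (l ++ [a])) := by
  rw [isChain_iff_isWalk, noBacktrack_append_head_iff]
  constructor
  · rintro ⟨⟨-, v, hv⟩, h2, h3, h4⟩
    obtain rfl : X.src a = v := hv.1
    refine ⟨⟨by simp, fun c n hn hc => h4 c n ?_ hn hc⟩, hv, h2, h3⟩
    obtain ⟨n, rfl⟩ := Nat.exists_eq_add_of_le' hn
    cases c with
    | nil => simp at hc
    | cons d c =>
      obtain rfl : a = d := by
        simp only [List.replicate_succ, List.flatten_cons, List.cons_append, List.cons.injEq] at hc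
        exact hc.1
      rw [hc, List.replicate_succ, List.replicate_succ, List.flatten_cons, List.flatten_cons,
        AbelianCover.isWalk_append] at hv
      obtain ⟨x, h1, h2⟩ := hv
      obtain rfl : X.src a = x := h2.1
      exact ⟨by simp, _, h1⟩
  · rintro ⟨⟨-, h1⟩, h2, h3, h4⟩
    exact ⟨⟨by simp, _, h2⟩, h3, h4, fun C n _ hn => h1 C n hn⟩

theorem chainWeight_edgeMatrix [DecidableEq X.V] [DecidableEq X.Dart] (b : X.Dart)
    (l : List X.Dart) : ∀ a : X.Dart,
    List.chainWeight (X.edgeMatrix θ) a l b =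
      if List.IsChain (fun e f => X.tgt e = X.src f ∧ f ≠ X.inv e) (a :: (l ++ [b])) then
        ((a :: l).map θ).prod else 0 := by
  induction l with
  | nil => intro a; simp [List.chainWeight, edgeMatrix]
  | cons c l ih =>
    intro a
    rw [List.chainWeight, ih]
    simp only [edgeMatrix, Matrix.of_apply, List.map_cons, List.prod_cons, List.cons_append,
      List.isChain_cons_cons]
    by_cases h1 : X.tgt a = X.src c ∧ c ≠ X.inv a
    · simp [h1]
    · rw [if_neg h1, zero_mul, if_neg fun h => h1 h.1]

/-- The Euler product over the primes of a graph, for weights which are multiplicative along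
paths. -/
theorem hasProd_primeClass [Fintype X.Dart] [DecidableEq X.V] [DecidableEq X.Dart]
    (ω : X.PrimeClass → ℂ) (hω : ∀ (p : X.PrimeClass) (l : List X.Dart), X.IsPrimePath l →
      (l : Cycle X.Dart) = p.1 → ω p = (l.map θ).prod) :
    ∀ᶠ u : ℂ in 𝓝 0, HasProd (fun p : X.PrimeClass => (1 - ω p * u ^ p.length)⁻¹)
      ((1 - u • X.edgeMatrix θ).det)⁻¹ := by
  set W := X.edgeMatrix θ with hW
  let wt : Cycle X.Dart → ℂ := Quotient.lift (List.cyclicWeight W) (by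
    rintro l l' ⟨n, rfl⟩
    exact (List.cyclicWeight_rotate W l n).symm)
  have hwt : ∀ l : List X.Dart, wt l = List.cyclicWeight W l := fun _ => rfl
  filter_upwards [List.hasProd_primitiveCycle W hwt] with u hu
  let F : Cycle X.Dart → ℂ := fun c => (1 - wt c * u ^ c.length)⁻¹
  let P : Set (Cycle X.Dart) := {c | ∃ l, X.IsPrimePath l ∧ (l : Cycle X.Dart) = c}
  let Q : Set (Cycle X.Dart) := {c | ∃ l : List X.Dart, l.IsPrimitiveWord ∧ (l : Cycle X.Dart) = c}
  have hu' : HasProd (F ∘ ((↑) : Q → Cycle X.Dart)) ((1 - u • W).det)⁻¹ := hu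
  have hF : ∀ p : X.PrimeClass, (1 - ω p * u ^ p.length)⁻¹ = F p.1 := by
    intro p
    obtain ⟨l, hl, hp⟩ := p.2
    have : ω p = wt p.1 := by
      rw [hω p l hl hp, ← hp, hwt]
      cases l with
      | nil => exact absurd rfl hl.1.1
      | cons a l =>
        rw [List.cyclicWeight, hW, chainWeight_edgeMatrix, if_pos ((X.isPrimePath_iff a l).1 hl).2]
    rw [this]
    rfl
  -- A primitive cycle that is not a prime passes through a zero entry of `W`, so its Euler factor
  -- is `1`.
  have hPQ : P.mulIndicator F = Q.mulIndicator F := by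
    funext c
    induction c using Quotient.inductionOn with | h l =>
    change P.mulIndicator F (l : Cycle X.Dart) = Q.mulIndicator F (l : Cycle X.Dart)
    by_cases hP : (l : Cycle X.Dart) ∈ P
    · have hQ : (l : Cycle X.Dart) ∈ Q := by
        obtain ⟨l', h1, h2⟩ := hP
        cases l' with
        | nil => exact absurd rfl h1.1.1
        | cons a l' => exact ⟨_, ((X.isPrimePath_iff a l').1 h1).1, h2⟩
      rw [Set.mulIndicator_of_mem hP, Set.mulIndicator_of_mem hQ]
    · rw [Set.mulIndicator_of_notMem hP]
      by_cases hQ : (l : Cycle X.Dart) ∈ Q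
      · rw [Set.mulIndicator_of_mem hQ]
        obtain ⟨l', h1, h2⟩ := hQ
        rw [← h2] at hP ⊢
        cases l' with
        | nil => exact absurd rfl h1.1
        | cons a l' =>
          have hn : ¬ X.IsPrimePath (a :: l') := fun h => hP ⟨_, h, rfl⟩
          rw [isPrimePath_iff, not_and] at hn
          simp only [F, hwt, List.cyclicWeight, W]
          rw [chainWeight_edgeMatrix, if_neg (hn h1)]
          simp
      · rw [Set.mulIndicator_of_notMem hQ]
  rw [hasProd_subtype_iff_mulIndicator, ← hPQ, ← hasProd_subtype_iff_mulIndicator] at hu'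
  exact hu'.congr_fun hF

end Words

end Multigraph

/-! ### Voltages, Frobenius automorphisms and the twisted adjacency matrix. -/

namespace Multigraph

namespace AbelianCover

variable {Y : Multigraph.{u₂, v₂}} {X : Multigraph.{u₁, v₁}} (C : AbelianCover Y X)

theorem onV_tgt (e : Y.Dart) : C.π.onV (Y.tgt e) = X.tgt (C.π.onDart e) := by
  simp [tgt, C.π.inv_onDart, C.π.src_onDart]

theorem onV_act (g : C.G) (y : Y.V) : C.π.onV (C.π.act g y) = C.π.onV y := g.2.2.2.1 y

theorem act_one (y : Y.V) : C.π.act 1 y = y := rfl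

theorem tgt_apply (g : C.G) (e : Y.Dart) : Y.tgt (g.1.2 e) = C.π.act g (Y.tgt e) := by
  simp only [tgt, Hom.act, g.2.2.1 e, g.2.1]

variable {w : X.V → Y.V} (hw : ∀ v, C.π.onV (w v) = v)

theorem exists_voltage (w : X.V → Y.V) (hw : ∀ v, C.π.onV (w v) = v) (e : X.Dart) :
    ∃ (g : C.G) (e' : Y.Dart), C.π.onDart e' = e ∧
      Y.src e' = w (X.src e) ∧ Y.tgt e' = C.π.act g (w (X.tgt e)) := by
  obtain ⟨e', h1, h2⟩ := (C.isCovering.2 (w (X.src e))).surjOn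
    (show e ∈ {f | X.src f = C.π.onV (w (X.src e))} from (hw _).symm)
  obtain ⟨g, hg⟩ := C.transitive (w (X.tgt e)) (Y.tgt e') (by rw [hw, onV_tgt, h2])
  exact ⟨g, e', h2, h1, hg.symm⟩

/-- The voltage of an oriented edge `e` from `v` to `v'`: the automorphism `g` such that the lift of
`e` starting at the chosen vertex above `v` ends at the `g`-translate of the one above `v'`. -/
noncomputable def voltage (e : X.Dart) : C.G := (C.exists_voltage w hw e).choose

/-- By unique lifting, `e'` is the `h`-translate of the lift that defines the voltage. -/
theorem tgt_eq_of_src_eq (h : C.G) (e' : Y.Dart)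
    (he : Y.src e' = C.π.act h (w (X.src (C.π.onDart e')))) :
    Y.tgt e' = C.π.act (h * C.voltage hw (C.π.onDart e')) (w (X.tgt (C.π.onDart e'))) := by
  obtain ⟨f, h1, h2, h3⟩ := (C.exists_voltage w hw (C.π.onDart e')).choose_spec
  have : e' = h.1.2 f := by
    refine (C.isCovering.2 (Y.src e')).injOn rfl ?_ ?_
    · rw [Set.mem_ofPred_eq, h.2.1, h2, he]; rfl
    · rw [h.2.2.2.2, h1]
  rw [act_mul, voltage, ← h3, ← tgt_apply, ← this]

theorem voltage_mul_voltage_inv (hY : Y.IsConnected) (e : X.Dart) :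
    C.voltage hw e * C.voltage hw (X.inv e) = 1 := by
  obtain ⟨f, h1, h2, h3⟩ := (C.exists_voltage w hw e).choose_spec
  have h4 := C.tgt_eq_of_src_eq hw (C.voltage hw e) (Y.inv f) (by
    rw [← C.π.inv_onDart, h1]; exact h3)
  rw [tgt_inv, h2, ← C.π.inv_onDart, h1, tgt_inv] at h4
  exact C.act_injective hY _ _ (w (X.src e)) (h4.symm.trans (C.act_one _).symm)

theorem end_eq_of_isWalk (l : List Y.Dart) : ∀ (h : C.G) (v : X.V) (y : Y.V),
    Y.IsWalk (C.π.act h (w v)) l y →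
      y = C.π.act (h * ((l.map C.π.onDart).map (C.voltage hw)).prod) (w (C.π.onV y)) := by
  induction l with
  | nil =>
    rintro h v y rfl
    simp [onV_act, hw]
  | cons e l ih =>
    rintro h v y ⟨h1, h2⟩
    have hv : X.src (C.π.onDart e) = v := by rw [C.π.src_onDart, h1, onV_act, hw]
    rw [C.tgt_eq_of_src_eq hw h e (by rw [h1, hv])] at h2
    simpa [mul_assoc] using ih _ _ _ h2

/-- Lifting from the chosen vertex accumulates the voltages, so their product is a Frobenius;
uniqueness does the rest. -/
theorem frobenius_eq (hY : Y.IsConnected) (p : X.PrimeClass) (l : List X.Dart)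
    (hl : X.IsPrimePath l) (hp : (l : Cycle X.Dart) = p.1) :
    C.frobenius p = (l.map (C.voltage hw)).prod := by
  obtain ⟨v, hv⟩ := hl.1.2
  obtain ⟨l', y, rfl, h2, h3⟩ := C.exists_lift l (w v) v (by rwa [hw])
  have h4 := C.end_eq_of_isWalk hw l' 1 v y h2
  rw [h3, one_mul] at h4
  exact C.isFrobenius_unique hY p _ _ (C.exists_isFrobenius p).choose_spec
    ⟨_, l', w v, hl, hp, rfl, h4 ▸ h2⟩

open Classical in
-- The factor 2 for loops counts both orientations. In all other cases freeness of the action makes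
-- the two end points distinct, and one orientation of each edge counts.
theorem adjMatrix_apply [Fintype Y.Dart] (hY : Y.IsConnected) (hw : ∀ v, C.π.onV (w v) = v)
    (σ : C.G) (i j : X.V) : C.adjMatrix w σ i j =
      ∑ e : Y.Dart, if Y.src e = w i ∧ Y.tgt e = C.π.act σ (w j) then 1 else 0 := by
  simp only [adjMatrix, Matrix.of_apply]
  split_ifs with h
  · obtain ⟨rfl, rfl⟩ := h
    have := congrArg (Nat.cast (R := ℂ)) (Y.two_mul_numLoops_eq_sum (w i))
    push_cast at this
    exact this
  · have hne : w i ≠ C.π.act σ (w j) := by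
      intro h'
      have hij : i = j := by
        have := congrArg C.π.onV h'
        rwa [onV_act, hw, hw] at this
      subst hij
      exact h ⟨rfl, (C.act_injective hY _ _ (w i) (h'.symm.trans (C.act_one _).symm))⟩
    have := congrArg (Nat.cast (R := ℂ)) (Y.numEdges_eq_sum hne)
    push_cast at this
    exact this

/-- An oriented edge leaving `w i` contributes for a single σ, its voltage, and the covering
property matches these edges with those leaving `i`. -/
theorem twistedAdjMatrix_eq [DecidableEq X.V] [Fintype X.Dart] [Finite Y.V] [Finite Y.Dart]
    (hY : Y.IsConnected) (χ : C.G →* ℂˣ) :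
    C.twistedAdjMatrix w χ = X.weightedAdj fun e => (χ (C.voltage hw e) : ℂ) := by
  classical
  have := Fintype.ofFinite Y.Dart
  ext i j
  rw [twistedAdjMatrix, Matrix.sum_apply]
  simp only [Matrix.smul_apply, C.adjMatrix_apply hY hw, smul_eq_mul, Finset.mul_sum]
  rw [Finset.sum_comm]
  have h1 : ∀ e : Y.Dart, ∑ σ : C.G, (χ σ : ℂ) *
      (if Y.src e = w i ∧ Y.tgt e = C.π.act σ (w j) then 1 else 0) =
      if Y.src e = w i then (if X.tgt (C.π.onDart e) = j then
        (χ (C.voltage hw (C.π.onDart e)) : ℂ) else 0) else 0 := by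
    intro e
    by_cases hs : Y.src e = w i
    · have ht := C.tgt_eq_of_src_eq hw 1 e (by rw [C.π.src_onDart, hs, hw, act_one])
      rw [one_mul] at ht
      by_cases hj : X.tgt (C.π.onDart e) = j
      · rw [hj] at ht
        rw [Finset.sum_eq_single (C.voltage hw (C.π.onDart e))]
        · simp [hs, ht, hj]
        · intro σ _ hσ
          have : Y.tgt e ≠ C.π.act σ (w j) := fun h =>
            hσ (C.act_injective hY _ _ (w j) (h.symm.trans ht))
          simp [this]
        · simp
      · rw [if_pos hs, if_neg hj]
        refine Finset.sum_eq_zero fun σ _ => ?_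
        have : Y.tgt e ≠ C.π.act σ (w j) := fun h => hj (by rw [← onV_tgt, h, onV_act, hw])
        simp [this]
    · simp [hs]
  rw [Finset.sum_congr rfl fun e _ => h1 e]
  simp only [weightedAdj, Matrix.of_apply, ite_and]
  rw [← Finset.sum_filter fun e : Y.Dart => Y.src e = w i,
    ← Finset.sum_filter fun e : X.Dart => X.src e = i]
  have hbij := C.isCovering.2 (w i)
  rw [hw] at hbij
  refine Finset.sum_nbij C.π.onDart ?_ ?_ ?_ fun _ _ => rfl
  · intro e he; simpa using hbij.mapsTo (by simpa using he)
  · simpa using hbij.injOn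
  · simpa using hbij.surjOn

theorem character_prod (χ : C.G →* ℂˣ) (f : X.Dart → C.G) (l : List X.Dart) :
    (χ (l.map f).prod : ℂ) = (l.map fun e => (χ (f e) : ℂ)).prod := by
  induction l with
  | nil => simp
  | cons e l ih => simp [ih]

theorem norm_character [Finite Y.V] [Finite Y.Dart] (χ : C.G →* ℂˣ) (σ : C.G) :
    ‖(χ σ : ℂ)‖ = 1 := by
  have h : (χ σ : ℂ) ^ Fintype.card C.G = 1 := by
    rw [← Units.val_pow_eq_pow_val, ← map_pow, pow_card_eq_one, map_one, Units.val_one]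
  exact Complex.norm_eq_one_of_pow_eq_one h Fintype.card_ne_zero

end AbelianCover

/-! ### The kernel of the twisted Laplacian. -/

/-- A vector in the kernel of the twisted Laplacian is multiplied by the weight along each edge. -/
theorem eq_of_laplacian_mulVec_eq_zero {X : Multigraph.{u₁, v₁}} [Fintype X.V] [DecidableEq X.V]
    [Fintype X.Dart] {θ : X.Dart → ℂ} (hθ : ∀ e, ‖θ e‖ = 1) {x : X.V → ℂ}
    (hx : (X.degreeMatrix - X.weightedAdj θ).mulVec x = 0) (e : X.Dart) :
    x (X.src e) = θ e * x (X.tgt e) := by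
  have hfib : ∀ f : X.V → X.Dart → ℝ,
      ∑ v, ∑ e : X.Dart, (if X.src e = v then f v e else 0) = ∑ e, f (X.src e) e := by
    intro f
    rw [Finset.sum_comm]
    simp
  have h1 : ∀ v, (∑ e : X.Dart, if X.src e = v then x v - θ e * x (X.tgt e) else 0) = 0 := by
    intro v
    have := congrFun hx v
    rw [Matrix.sub_mulVec, Pi.sub_apply, Pi.zero_apply, degreeMatrix, Matrix.mulVec_diagonal,
      X.degree_eq_sum, Matrix.mulVec, dotProduct] at this
    refine Eq.trans ?_ this
    simp only [weightedAdj, Matrix.of_apply, Finset.sum_mul]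
    rw [Finset.sum_comm, Nat.cast_sum, Finset.sum_mul, ← Finset.sum_sub_distrib]
    refine Finset.sum_congr rfl fun e _ => ?_
    by_cases h : X.src e = v <;> simp [h]
  -- The kernel equation is paired with the conjugate of `x`.
  have h2 : ∑ e : X.Dart, ((starRingEnd ℂ) (x (X.src e)) *
      (x (X.src e) - θ e * x (X.tgt e))).re = 0 := by
    rw [← hfib fun v e => ((starRingEnd ℂ) (x v) * (x v - θ e * x (X.tgt e))).re]
    refine Finset.sum_eq_zero fun v _ => ?_
    have := congrArg (fun z => ((starRingEnd ℂ) (x v) * z).re) (h1 v)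
    simp only [Finset.mul_sum, Complex.re_sum, mul_zero, Complex.zero_re] at this
    refine Eq.trans ?_ this
    refine Finset.sum_congr rfl fun e _ => ?_
    split_ifs <;> simp
  have h3 : ∑ e : X.Dart, Complex.normSq (x (X.tgt e)) = ∑ e, Complex.normSq (x (X.src e)) :=
    Equiv.sum_comp ⟨X.inv, X.inv, X.inv_inv, X.inv_inv⟩ fun e => Complex.normSq (x (X.src e))
  -- With `b` the weighted end value, `|a - b|² = 2 Re (ā (a - b)) + |b|² - |a|²`; summed over
  -- edges, the first term vanishes by `h2` and the others cancel under inversion.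
  have h4 : ∑ e : X.Dart, Complex.normSq (x (X.src e) - θ e * x (X.tgt e)) = 0 := by
    have h5 : ∀ e : X.Dart, Complex.normSq (x (X.src e) - θ e * x (X.tgt e)) =
        2 * ((starRingEnd ℂ) (x (X.src e)) * (x (X.src e) - θ e * x (X.tgt e))).re +
          (Complex.normSq (x (X.tgt e)) - Complex.normSq (x (X.src e))) := by
      intro e
      have : Complex.normSq (θ e) = 1 := by rw [Complex.normSq_eq_norm_sq, hθ, one_pow]
      have h6 : Complex.normSq (x (X.tgt e)) = Complex.normSq (θ e * x (X.tgt e)) := by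
        rw [map_mul, this, one_mul]
      rw [h6]
      generalize θ e * x (X.tgt e) = b
      generalize x (X.src e) = a
      simp [Complex.normSq_apply]
      ring
    rw [Finset.sum_congr rfl fun e _ => h5 e, Finset.sum_add_distrib, ← Finset.mul_sum, h2,
      Finset.sum_sub_distrib, h3]
    simp
  have h5 := (Finset.sum_eq_zero_iff_of_nonneg fun e _ => Complex.normSq_nonneg _).1 h4 e
    (Finset.mem_univ e)
  exact sub_eq_zero.1 (Complex.normSq_eq_zero.1 h5)

theorem eq_prod_mul_of_isWalk {X : Multigraph.{u₁, v₁}} {θ : X.Dart → ℂ} {x : X.V → ℂ}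
    (hx : ∀ e, x (X.src e) = θ e * x (X.tgt e)) (l : List X.Dart) :
    ∀ v v', X.IsWalk v l v' → x v = (l.map θ).prod * x v' := by
  induction l with
  | nil => rintro v v' rfl; simp
  | cons e l ih =>
    rintro v v' ⟨rfl, h⟩
    rw [hx, ih _ _ h, List.map_cons, List.prod_cons, mul_assoc]

namespace AbelianCover

variable {Y : Multigraph.{u₂, v₂}} {X : Multigraph.{u₁, v₁}} (C : AbelianCover Y X)

theorem isWalk_map (l : List Y.Dart) : ∀ y y', Y.IsWalk y l y' →
    X.IsWalk (C.π.onV y) (l.map C.π.onDart) (C.π.onV y') := by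
  induction l with
  | nil => rintro y y' rfl; rfl
  | cons e l ih =>
    rintro y y' ⟨rfl, h⟩
    exact ⟨C.π.src_onDart e, C.onV_tgt e ▸ ih _ _ h⟩

/-- For each `g`, a path in `Y` from `w v` to its `g`-translate projects to a closed walk with
voltage product `g`. Transporting a kernel vector around it at a `v` where it is nonzero gives `χ g
= 1`. -/
theorem det_laplacian_ne_zero [Fintype X.V] [DecidableEq X.V] [Finite X.Dart] [Finite Y.V]
    [Finite Y.Dart] (hY : Y.IsConnected) {w : X.V → Y.V} (hw : ∀ v, C.π.onV (w v) = v)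
    {χ : C.G →* ℂˣ} (hχ : χ ≠ 1) : (X.degreeMatrix - C.twistedAdjMatrix w χ).det ≠ 0 := by
  have := Fintype.ofFinite X.Dart
  intro hdet
  obtain ⟨x, hx0, hx⟩ := Matrix.exists_mulVec_eq_zero_iff.2 hdet
  rw [C.twistedAdjMatrix_eq hw hY] at hx
  have hedge := eq_of_laplacian_mulVec_eq_zero (fun e => C.norm_character χ _) hx
  obtain ⟨v, hv⟩ := Function.ne_iff.1 hx0
  apply hχ
  ext g
  obtain ⟨l, hl⟩ := hY.2 (w v) (C.π.act g (w v))
  have h1 := C.end_eq_of_isWalk hw l 1 v _ hl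
  rw [onV_act, hw, one_mul] at h1
  have h2 := C.act_injective hY _ _ _ h1
  have h3 := eq_prod_mul_of_isWalk hedge _ _ _ (C.isWalk_map l _ _ hl)
  rw [onV_act, hw] at h3
  have h4 : ((l.map C.π.onDart).map fun e => (χ (C.voltage hw e) : ℂ)).prod = χ g := by
    rw [h2, character_prod]
  rw [h4] at h3
  simpa using (mul_right_cancel₀ hv (by rw [← h3, one_mul] : (χ g : ℂ) * x v = 1 * x v))

/-! ### The `L`-function as a determinant, and uniqueness of its continuation. -/

/-- The reciprocal of the `L`-function, as given by the Ihara-Bass formula. -/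
noncomputable def iharaDet [Fintype X.V] [DecidableEq X.V] [Finite Y.V] [Finite Y.Dart]
    (w : X.V → Y.V) (χ : C.G →* ℂˣ) (u : ℂ) : ℂ :=
  ((1 - u ^ 2) • (1 : Matrix X.V X.V ℂ) - u • C.twistedAdjMatrix w χ +
    u ^ 2 • X.degreeMatrix).det

theorem analyticAt_iharaDet [Fintype X.V] [DecidableEq X.V] [Finite Y.V] [Finite Y.Dart]
    (w : X.V → Y.V) (χ : C.G →* ℂˣ) (u : ℂ) : AnalyticAt ℂ (C.iharaDet w χ) u := by
  have h : Differentiable ℂ (C.iharaDet w χ) := by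
    unfold iharaDet
    simp only [Matrix.det_apply, Matrix.add_apply, Matrix.sub_apply, Matrix.smul_apply, smul_eq_mul,
      Units.smul_def]
    fun_prop
  exact h.analyticAt u

theorem iharaDet_one [Fintype X.V] [DecidableEq X.V] [Finite Y.V] [Finite Y.Dart]
    (w : X.V → Y.V) (χ : C.G →* ℂˣ) :
    C.iharaDet w χ 1 = (X.degreeMatrix - C.twistedAdjMatrix w χ).det := by
  rw [iharaDet]
  congr 1
  simp only [one_pow, sub_self, zero_smul, one_smul]
  abel

/-- The Ihara-Bass formula. -/
theorem isArtinIharaL_iharaDet [Fintype X.V] [DecidableEq X.V] [Finite X.Dart] [Finite Y.V]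
    [Finite Y.Dart] (hY : Y.IsConnected) {w : X.V → Y.V} (hw : ∀ v, C.π.onV (w v) = v)
    (χ : C.G →* ℂˣ) :
    C.IsArtinIharaL χ fun u => ((1 - u ^ 2) ^ (X.cycleRank - 1) * C.iharaDet w χ u)⁻¹ := by
  classical
  have := Fintype.ofFinite X.Dart
  refine ⟨fun u _ => ?_, ?_⟩
  · have h1 : MeromorphicAt (fun u : ℂ => 1 - u ^ 2) u := by fun_prop
    exact ((h1.zpow _).mul (C.analyticAt_iharaDet w χ u).meromorphicAt).inv
  · let θ : X.Dart → ℂ := fun e => χ (C.voltage hw e)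
    have hθ : ∀ e, θ e * θ (X.inv e) = 1 := fun e => by
      rw [← Units.val_mul, ← map_mul, C.voltage_mul_voltage_inv hw hY, map_one, Units.val_one]
    have hu0 : ∀ᶠ u : ℂ in 𝓝 0, 1 - u ^ 2 ≠ 0 := by
      have : ContinuousAt (fun u : ℂ => 1 - u ^ 2) 0 := by fun_prop
      exact this.eventually_ne (by simp)
    filter_upwards [hu0, X.hasProd_primeClass (θ := θ) (fun p => (χ (C.frobenius p) : ℂ))
      (fun p l hl hp => by
        rw [C.frobenius_eq hw hY p l hl hp, character_prod])] with u hu h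
    rw [X.det_one_sub_smul_edgeMatrix hθ hu, ← C.twistedAdjMatrix_eq hw hY χ] at h
    have hr : X.cycleRank - 1 = (Nat.card X.Edge : ℤ) - Nat.card X.V := by
      rw [cycleRank]; ring
    rw [hr]
    exact h

/-- The identity theorem on the connected plane, starting from agreement near 0. Only punctured
neighbourhoods can be compared, as values of meromorphic functions at isolated points are
unconstrained. -/
theorem IsArtinIharaL.eventuallyEq {χ : C.G →* ℂˣ} {L L' : ℂ → ℂ} (hL : C.IsArtinIharaL χ L)
    (hL' : C.IsArtinIharaL χ L') (z : ℂ) : L =ᶠ[𝓝[≠] z] L' := by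
  have hm : MeromorphicOn (L - L') Set.univ := hL.1.sub hL'.1
  have h0 : meromorphicOrderAt (L - L') 0 = ⊤ := by
    rw [meromorphicOrderAt_eq_top_iff]
    refine Filter.Eventually.filter_mono nhdsWithin_le_nhds ?_
    filter_upwards [hL.2, hL'.2] with u h1 h2
    simp [h1.unique h2]
  have hz : meromorphicOrderAt (L - L') z = ⊤ := by
    by_contra h
    exact hm.meromorphicOrderAt_ne_top_of_isPreconnected isPreconnected_univ (Set.mem_univ z)
      (Set.mem_univ 0) h h0
  filter_upwards [meromorphicOrderAt_eq_top_iff.1 hz] with u hu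
  exact sub_eq_zero.1 hu

end AbelianCover

end Multigraph

/-! ### Order and leading coefficient at `u = 1`. -/

theorem mainTheorem8 {X : Multigraph.{u₁, v₁}} {Y : Multigraph.{u₂, v₂}}
    [Fintype X.V] [DecidableEq X.V] [Finite X.Dart] [Finite Y.V] [Finite Y.Dart]
    (hX : X.IsConnected) (hY : Y.IsConnected)
    (hdeg : ∀ v : X.V, X.degree v ≠ 1)
    (C : Multigraph.AbelianCover Y X)
    (w : X.V → Y.V) (hw : ∀ v, C.π.onV (w v) = v)
    (χ : C.G →* ℂˣ) (hχ : χ ≠ 1) :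
    (∃ L : ℂ → ℂ, C.IsArtinIharaL χ L) ∧
    ∀ L : ℂ → ℂ, C.IsArtinIharaL χ L →
      meromorphicOrderAt (fun u => (L u)⁻¹) 1 = ((X.cycleRank - 1 : ℤ) : WithTop ℤ) ∧
      meromorphicTrailingCoeffAt (fun u => (L u)⁻¹) 1 =
        (-2) ^ (X.cycleRank - 1) * (X.degreeMatrix - C.twistedAdjMatrix w χ).det := by
  refine ⟨⟨_, C.isArtinIharaL_iharaDet hY hw χ⟩, fun L hL => ?_⟩
  -- The cofactor of `(u - 1) ^ (r - 1)`, from `1 - u ^ 2 = (u - 1) * (-(1 + u))`; its base is `-2`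
  -- at `u = 1`, so integer powers stay analytic there.
  let g : ℂ → ℂ := fun u => (-(1 + u)) ^ (X.cycleRank - 1) * C.iharaDet w χ u
  have hg : AnalyticAt ℂ g 1 := by
    have h1 : AnalyticAt ℂ (fun u : ℂ => -(1 + u)) 1 := by fun_prop
    exact (h1.zpow (by norm_num)).mul (C.analyticAt_iharaDet w χ 1)
  have hg1 : g 1 = (-2) ^ (X.cycleRank - 1) * (X.degreeMatrix - C.twistedAdjMatrix w χ).det := by
    simp only [g, C.iharaDet_one]
    norm_num
  have hg0 : g 1 ≠ 0 := by
    rw [hg1]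
    exact mul_ne_zero (zpow_ne_zero _ (by norm_num)) (C.det_laplacian_ne_zero hY hw hχ)
  have heq : (fun u => (L u)⁻¹) =ᶠ[𝓝[≠] 1] fun u => (u - 1) ^ (X.cycleRank - 1) • g u := by
    filter_upwards [hL.eventuallyEq C (C.isArtinIharaL_iharaDet hY hw χ) 1] with u hu
    rw [hu, inv_inv, smul_eq_mul, ← mul_assoc, ← mul_zpow]
    congr 2
    ring
  refine ⟨?_, ?_⟩
  · exact (meromorphicOrderAt_eq_int_iff (hL.1 1 (Set.mem_univ 1)).fun_inv).2
      ⟨g, hg, hg0, heq⟩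
  · rw [hg.meromorphicTrailingCoeffAt_of_ne_zero_of_eq_nhdsNE hg0 heq, hg1]
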